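/- Let $\mathcal Y=\{0,1\}$, let $\mathcal Z$ be a finite set, $\mathcal X=\mathcal Y\times\mathcal Z$, and $\xi:\mathcal X\to\mathcal Y$, $\xi(y,z)=y$. A \emph{generator} on a finite set is a real matrix with non-negative off-diagonal entries and zero row sums; it is \emph{irreducible} if any state can be reached from any other through transitions of positive rate. Let $Q_0,Q_1\in\mathbb R^{\mathcal Z\times\mathcal Z}$ be irreducible generators, let $G_{0,1},G_{1,0}\in\mathbb R^{\mathcal Z\times\mathcal Z}$, let $D_y$ be the diagonal matrix with entries $D_y(z)=-\sum_{z'}G_{y,1-y}(z,z')$, and suppose that, for every $\varepsilon>0$, $$L^\varepsilon=\frac1\varepsilon\begin{pmatrix}Q_0&0\\0&Q_1\end{pmatrix}+\begin{pmatrix}D_0&G_{0,1}\\G_{1,0}&D_1\end{pmatrix}$$ is an irreducible generator on $\mathcal X$. Let $\rho^\varepsilon$ be its stationary probability measure. For a probability measure $\nu$ on $\mathcal X$ write $\xi_\#\nu(y)=\sum_z\nu(y,z)$ and $\nu(z|y)=\nu(y,z)/\xi_\#\nu(y)$. For probability measures $\nu,\zeta$ on a finite set let $\mathscr H(\nu|\zeta)=\sum_x\nu(x)\log\frac{\nu(x)}{\zeta(x)}$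 be the relative entropy ($+\infty$ if $\nu\not\ll\zeta$), and, for $\zeta$ positive and a generator $M$, let $$\mathscr R_M(\nu|\zeta)=\sum_{x,x'}\Bigl[-M(x,x')\log\frac{\nu(x')}{\zeta(x')}+M(x,x')\frac{\nu(x')\zeta(x)}{\nu(x)\zeta(x')}\Bigr]\nu(x)$$ be the Fisher information, where the factor $\nu(x)$ is multiplied out, $0\log 0=0$, and the value is $+\infty$ if $M(x,x')>0$, $\nu(x)>0$ and $\nu(x')=0$ for some $x,x'$. Fix $T>0$. For each $\varepsilon$ let $\mu^\varepsilon:[0,T]\to\mathcal P(\mathcal X)$ solve $\partial_t\mu^\varepsilon_t=(L^\varepsilon)^T\mu^\varepsilon_t$. Let $\hat\mu^\varepsilon:[0,T]\to\mathcal P(\mathcal Y)$ be the coarse-grained dynamics, i.e. the solution of $$\partial_t\hat\mu^\varepsilon_t=(\hat L^\varepsilon_t)^T\hat\mu^\varepsilon_t,\quad \hat\mu_0^\varepsilon=\xi_\#\mu^\varepsilon_0,\qquad \hat L^\varepsilon_t(y_1,y_2)=\sum_{z_1,z_2}L^\varepsilon((y_1,z_1),(y_2,z_2))\,\mu^\varepsilon_t(z_1|y_1),$$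 and let $\eta^\varepsilon:[0,T]\to\mathcal P(\mathcal Y)$ be the effective dynamics with initial datum $\eta^\varepsilon_0$, i.e. the solution of $$\partial_t\eta^\varepsilon_t=(N^\varepsilon)^T\eta^\varepsilon_t,\qquad N^\varepsilon(y_1,y_2)=\sum_{z_1,z_2}L^\varepsilon((y_1,z_1),(y_2,z_2))\,\rho^\varepsilon(z_1|y_1).$$ (The conditional measure $\mu_t^\varepsilon(\cdot|y)$ is undefined only where $\hat\mu^\varepsilon_t(y)=0$; there any value may be used.) Assume that there are $\varepsilon_0>0$ and $\alpha>0$ such that the log-Sobolev inequality $$\mathscr H(\nu\,|\,\rho^\varepsilon(\cdot|y))\le\frac1\alpha\,\mathscr R_{Q_y}(\nu\,|\,\rho^\varepsilon(\cdot|y))$$ holds for all $\varepsilon\in(0,\varepsilon_0)$, $y\in\mathcal Y$ and $\nu\in\mathcal P(\mathcal Z)$, and that $\hat\mu^\varepsilon_0$ and $\eta^\varepsilon_0$ converge in $\mathcal P(\mathcal Y)$ as $\varepsilon\to0$ (the initial data need not be positive, and the two limits may differ). Then for every $\delta>0$ there is a constant $c>0$, independent of $\varepsilon$ and $t$, such that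 for all $\varepsilon\in(0,\varepsilon_0)$ and all $t\in[\delta,T]$ $$\mathscr H(\hat\mu^\varepsilon_t|\eta^\varepsilon_t)\le\mathscr H(\hat\mu^\varepsilon_\delta|\eta^\varepsilon_\delta)+c\sqrt{\frac{2\varepsilon T}{\alpha}}\,\bigl[\mathscr H(\mu^\varepsilon_0|\rho^\varepsilon)-\mathscr H(\mu^\varepsilon_t|\rho^\varepsilon)\bigr]^{1/2},$$ where the right-hand side is finite and well defined: $\mathscr H(\hat\mu^\varepsilon_\delta|\eta^\varepsilon_\delta)<\infty$ and $\mathscr H(\mu^\varepsilon_t|\rho^\varepsilon)\le\mathscr H(\mu^\varepsilon_0|\rho^\varepsilon)<\infty$. -/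

import Mathlib

open Set Filter Topology Matrix

noncomputable section

namespace MarkovCG

section General

variable {X Y : Type*} [Fintype X] [Fintype Y] [DecidableEq Y]

/-- The rows of a generator sum to zero and its off-diagonal entries are non-negative. -/
def IsGenerator (M : Matrix X X ℝ) : Prop :=
  (∀ x x', x ≠ x' → 0 ≤ M x x') ∧ ∀ x, ∑ x', M x x' = 0

/-- A generator is irreducible if every state can be reached from every other one along
transitions of positive rate. (Diagonal entries of a generator are never positive.) -/
def IsIrreducibleGenerator (M : Matrix X X ℝ) : Prop :=
  IsGenerator M ∧ ∀ x x', Relation.ReflTransGen (fun a b => 0 < M a b) x x'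

/-- `ζ` is a stationary probability measure of `M`. Probability measures on a finite set are
elements of the standard simplex. -/
def IsStationaryMeasure (M : Matrix X X ℝ) (ζ : X → ℝ) : Prop :=
  ζ ∈ stdSimplex ℝ X ∧ Mᵀ *ᵥ ζ = 0

/-- `p` is a curve of probability measures on `[0, T]` that solves `∂ₜ p = (A t)ᵀ p`
(one-sided derivatives at the end points). -/
def IsForwardSolution (A : ℝ → Matrix X X ℝ) (T : ℝ) (p : ℝ → X → ℝ) : Prop :=
  ∀ t ∈ Icc 0 T, p t ∈ stdSimplex ℝ X ∧ HasDerivWithinAt p ((A t)ᵀ *ᵥ p t) (Icc 0 T) t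

open Classical in
/-- The relative entropy `H(ν | ζ)`, with value `+∞` if `ν` is not absolutely continuous
with respect to `ζ`. -/
def relEntropy (ν ζ : X → ℝ) : EReal :=
  if ∀ x, ζ x = 0 → ν x = 0 then ((∑ x, ν x * Real.log (ν x / ζ x) : ℝ) : EReal) else ⊤

open Classical in
/-- The `M`-Fisher information
`R_M(ν | ζ) = ∑ x, ∑ x', [-M(x,x') log (ν(x')/ζ(x')) + M(x,x') ν(x')ζ(x)/(ν(x)ζ(x'))] ν(x)`
of a probability measure `ν` with respect to a positive probability measure `ζ`, for a
generator `M`. The factor `ν(x)` is multiplied out, so that the formula also makes sense where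
`ν(x) = 0` (with `0 · log 0 = 0`). A summand with `M(x,x') > 0`, `ν(x) > 0` and `ν(x') = 0`
equals `+∞`. -/
def fisherInfo (M : Matrix X X ℝ) (ν ζ : X → ℝ) : EReal :=
  if ∃ x x', 0 < M x x' ∧ 0 < ν x ∧ ν x' = 0 then ⊤
  else ((∑ x, ∑ x', (-(M x x' * Real.log (ν x' / ζ x')) * ν x
      + M x x' * (ν x' * ζ x / ζ x')) : ℝ) : EReal)

/-- The log-Sobolev inequality with constant `α` for the measure `ζ` and the matrix `M`. -/
def LogSobolev (α : ℝ) (M : Matrix X X ℝ) (ζ : X → ℝ) : Prop :=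
  ∀ ν ∈ stdSimplex ℝ X, relEntropy ν ζ ≤ ((1 / α : ℝ) : EReal) * fisherInfo M ν ζ

/-- The marginal (push-forward) `ξ_# ν`. -/
def marginal (ξ : X → Y) (ν : X → ℝ) (y : Y) : ℝ :=
  ∑ x with ξ x = y, ν x

/-- The conditional measure `ν(x | y)`, for `x` in the level set `{ξ = y}`. -/
def condMeasure (ξ : X → Y) (ν : X → ℝ) (y : Y) (x : X) : ℝ :=
  ν x / marginal ξ ν y

/-- The generator on `Y` obtained by averaging `L` with the conditional measures of `ν`:
`(y₁, y₂) ↦ ∑_{x₁ ∈ {ξ = y₁}} ∑_{x₂ ∈ {ξ = y₂}} L(x₁, x₂) ν(x₁ | y₁)`.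
With `ν = μ_t` it is the coarse-grained generator at time `t`, with `ν` the stationary measure
of `L` it is the effective generator. -/
def averagedGenerator (ξ : X → Y) (L : Matrix X X ℝ) (ν : X → ℝ) : Matrix Y Y ℝ :=
  Matrix.of fun y₁ y₂ =>
    ∑ x₁ with ξ x₁ = y₁, ∑ x₂ with ξ x₂ = y₂, L x₁ x₂ * condMeasure ξ ν y₁ x₁

/-- `m` is the coarse-grained dynamics of the curve `μ` driven by `L`: it solves the equation
with the time-dependent coarse-grained generator and starts in the marginal of `μ 0`. -/
def IsCoarseGrained (ξ : X → Y) (L : Matrix X X ℝ) (T : ℝ) (μ : ℝ → X → ℝ)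
    (m : ℝ → Y → ℝ) : Prop :=
  IsForwardSolution (fun t => averagedGenerator ξ L (μ t)) T m ∧ m 0 = marginal ξ (μ 0)

/-- `η` is an effective dynamics for `L` with stationary measure `ρ`. -/
def IsEffective (ξ : X → Y) (L : Matrix X X ℝ) (T : ℝ) (ρ : X → ℝ) (η : ℝ → Y → ℝ) : Prop :=
  IsForwardSolution (fun _ => averagedGenerator ξ L ρ) T η

end General

section ScaleSeparation

variable {Z : Type*} [Fintype Z] [DecidableEq Z]

/-- The fast part: block diagonal with blocks `Q 0`, `Q 1`. -/
def fastPart (Q : Fin 2 → Matrix Z Z ℝ) : Matrix (Fin 2 × Z) (Fin 2 × Z) ℝ :=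
  Matrix.of fun x x' => if x'.1 = x.1 then Q x.1 x.2 x'.2 else 0

/-- The slow part: `G y` holds the rates from macro-state `y` to macro-state `1 - y`, and the
diagonal is such that the rows sum to zero. -/
def slowPart (G : Fin 2 → Matrix Z Z ℝ) : Matrix (Fin 2 × Z) (Fin 2 × Z) ℝ :=
  Matrix.of fun x x' =>
    if x'.1 ≠ x.1 then G x.1 x.2 x'.2
    else if x'.2 = x.2 then -∑ z, G x.1 x.2 z
    else 0

/-- The scale-separated generator `L^ε = ε⁻¹ Q + G`. -/
def scaleGenerator (Q G : Fin 2 → Matrix Z Z ℝ) (ε : ℝ) :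
    Matrix (Fin 2 × Z) (Fin 2 × Z) ℝ :=
  (1 / ε) • fastPart Q + slowPart G

end ScaleSeparation

end MarkovCG

end

open MarkovCG

namespace MarkovCG

/-! Write `A` for the coarse-grained generator at time t and `N` for the effective one. The
coarse-grained dynamics is the curve of marginals of `μ`, so `A` and `N` average the same order-one
jump rates, against the conditionals of `μ` at time t and of `ρ` respectively. Differentiating
H(m|η) gives minus the `N`-Fisher information, which has a good sign, plus an error ∑ (A - N)(y,y')
m(y) log(m(y')/η(y')).

The logarithm is bounded uniformly in ε once m and η stay away from 0, which holds from time δ on: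
each exit at rate O(1/ε) costs only a constant factor over a time O(ε), fast transitions fill a
block in that time, and slow jumps carry mass across in time O(1) (`exists_le_marginal`,
`exists_le_effective`). The difference A - N is controlled by the L¹ distance of the conditionals,
hence through a Pinsker inequality and the log-Sobolev inequality by the Fisher information of the
fast blocks. That quantity is at most ε times the full Fisher information
(`sum_marginal_mul_realFisherInfo_le`), i.e. ε times the dissipation rate of H(μ|ρ).

The square root from Pinsker is linearised with a parameter β, the bound is integrated in time
(`realEntropy_coarse_sub_le`), and β is optimised at the end, which produces √ε. -/

/-! ### Elementary real inequalities -/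

theorem exists_pos_le_of_finite {ι : Type*} [Finite ι] (f : ι → ℝ) (hf : ∀ i, 0 < f i) :
    ∃ c : ℝ, 0 < c ∧ ∀ i, c ≤ f i := by
  rcases isEmpty_or_nonempty ι with h | h
  · exact ⟨1, one_pos, fun i => h.elim i⟩
  · obtain ⟨i, hi⟩ := Finite.exists_min f
    exact ⟨f i, hf i, hi⟩

theorem exists_ge_of_finite {ι : Type*} [Finite ι] (f : ι → ℝ) :
    ∃ C : ℝ, 0 < C ∧ ∀ i, f i ≤ C := by
  rcases isEmpty_or_nonempty ι with h | h
  · exact ⟨1, one_pos, fun i => h.elim i⟩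
  · obtain ⟨i, hi⟩ := Finite.exists_max f
    exact ⟨max 1 (f i), by positivity, fun j => (hi j).trans (le_max_right _ _)⟩

/-- A linear differential inequality `f' ≥ κ - Λ f` integrated. -/
theorem exp_mul_add_le_of_deriv_ge {f g : ℝ → ℝ} {s t κ Λ : ℝ} (hst : s ≤ t) (hΛ : 0 ≤ Λ)
    (hκ : 0 ≤ κ) (hf : ∀ u ∈ Icc s t, HasDerivWithinAt f (g u) (Icc s t) u)
    (hg : ∀ u ∈ Icc s t, κ - Λ * f u ≤ g u) :
    Real.exp (-(Λ * (t - s))) * (f s + κ * (t - s)) ≤ f t := by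
  -- Integrating factor. Subtracting the linear term κ(u - s) is enough for monotonicity, because
  -- the exponential is at least 1.
  have hd : ∀ u ∈ Icc s t, HasDerivWithinAt (fun u => Real.exp (Λ * (u - s)) * f u - κ * (u - s))
      (Real.exp (Λ * (u - s)) * Λ * f u + Real.exp (Λ * (u - s)) * g u - κ) (Icc s t) u := by
    intro u hu
    have h1 : HasDerivAt (fun u => Λ * (u - s)) Λ u := by
      simpa using ((hasDerivAt_id u).sub_const s).const_mul Λ
    have h2 : HasDerivAt (fun u => κ * (u - s)) κ u := by
      simpa using ((hasDerivAt_id u).sub_const s).const_mul κ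
    exact (h1.exp.hasDerivWithinAt.mul (hf u hu)).sub h2.hasDerivWithinAt
  have hm := monotoneOn_of_deriv_nonneg (convex_Icc s t)
    (fun u hu => (hd u hu).continuousWithinAt)
    (fun u hu => ((hd u (interior_subset hu)).mono interior_subset).differentiableWithinAt)
    (by
      intro u hu
      have hu' : u ∈ Icc s t := interior_subset hu
      rw [((hd u hu').hasDerivAt (mem_interior_iff_mem_nhds.mp hu)).deriv]
      have h1 := hg u hu'
      have h2 : 1 ≤ Real.exp (Λ * (u - s)) :=
        Real.one_le_exp (mul_nonneg hΛ (sub_nonneg.2 hu'.1))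
      nlinarith [mul_le_mul_of_nonneg_left h1 (Real.exp_pos (Λ * (u - s))).le,
        mul_le_mul_of_nonneg_right h2 hκ])
  have h := hm (left_mem_Icc.2 hst) (right_mem_Icc.2 hst) hst
  simp only [sub_self, mul_zero, Real.exp_zero, one_mul, sub_zero] at h
  have he : Real.exp (-(Λ * (t - s))) * Real.exp (Λ * (t - s)) = 1 := by
    rw [← Real.exp_add]; simp
  calc Real.exp (-(Λ * (t - s))) * (f s + κ * (t - s))
      ≤ Real.exp (-(Λ * (t - s))) * (Real.exp (Λ * (t - s)) * f t) :=
        mul_le_mul_of_nonneg_left (by linarith) (Real.exp_pos _).le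
    _ = f t := by rw [← mul_assoc, he, one_mul]

theorem le_two_mul_sqrt_of_forall_le {x A B : ℝ} (hA : 0 ≤ A) (hB : 0 < B)
    (h : ∀ β : ℝ, 0 < β → x ≤ β * A + B / β) : x ≤ 2 * √(A * B) := by
  rcases hA.eq_or_lt with rfl | hA
  · simp only [zero_mul, Real.sqrt_zero, mul_zero]
    by_contra! hx
    -- For A = 0 the infimum over β is only approached as β → ∞; this finite choice already yields x
    -- ≤ x/2.
    have := h (2 * B / x) (by positivity)
    have e : B / (2 * B / x) = x / 2 := by field_simp
    rw [e] at this
    linarith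
  -- The minimiser of βA + B/β.
  · have := h (√B / √A) (by positivity)
    have e : √B / √A * A + B / (√B / √A) = 2 * √(A * B) := by
      rw [Real.sqrt_mul hA.le]
      have h1 := Real.mul_self_sqrt hA.le
      have h2 := Real.mul_self_sqrt hB.le
      have := Real.sqrt_pos.2 hA
      have := Real.sqrt_pos.2 hB
      field_simp
      nlinarith
    rwa [e] at this

/-! ### Relative entropy and Fisher information as real numbers -/

section Entropy

variable {X : Type*} [Fintype X]

/-- The relative entropy of absolutely continuous measures, as a real number. -/
noncomputable def realEntropy (ν ζ : X → ℝ) : ℝ := ∑ x, ν x * Real.log (ν x / ζ x)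

/-- The Fisher information of positive measures, as a real number. -/
noncomputable def realFisherInfo (M : Matrix X X ℝ) (ν ζ : X → ℝ) : ℝ :=
  ∑ x, ∑ x', (-(M x x' * Real.log (ν x' / ζ x')) * ν x + M x x' * (ν x' * ζ x / ζ x'))

theorem relEntropy_eq_realEntropy {ν ζ : X → ℝ} (hζ : ∀ x, 0 < ζ x) :
    relEntropy ν ζ = (realEntropy ν ζ : EReal) :=
  if_pos fun x hx => absurd hx (hζ x).ne'

theorem fisherInfo_eq_realFisherInfo {M : Matrix X X ℝ} {ν ζ : X → ℝ} (hν : ∀ x, 0 < ν x) :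
    fisherInfo M ν ζ = (realFisherInfo M ν ζ : EReal) :=
  if_neg fun ⟨_, x', _, _, h⟩ => (hν x').ne' h

/-- Apply log u ≤ u - 1 to the ratio u of the densities at x' and x; vanishing row sums absorb the
terms depending on x alone. Stationarity of ζ plays no role, so this applies to the slow part and to
the effective generator with a moving reference. -/
theorem realFisherInfo_nonneg {M : Matrix X X ℝ} (hM : IsGenerator M) {ν ζ : X → ℝ}
    (hν : ∀ x, 0 < ν x) (hζ : ∀ x, 0 < ζ x) : 0 ≤ realFisherInfo M ν ζ := by
  unfold realFisherInfo
  refine Finset.sum_nonneg fun x _ => ?_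
  have h0 : ∑ x', M x x' * (ν x - ν x * Real.log (ν x / ζ x)) = 0 := by
    rw [← Finset.sum_mul, hM.2 x, zero_mul]
  rw [← h0]
  refine Finset.sum_le_sum fun x' _ => ?_
  rcases eq_or_ne x x' with rfl | hne
  · refine le_of_eq ?_
    rw [mul_div_cancel_right₀ _ (hζ x).ne']
    ring
  · have hu := Real.log_le_sub_one_of_pos
      (div_pos (div_pos (hν x') (hζ x')) (div_pos (hν x) (hζ x)))
    rw [Real.log_div (div_pos (hν x') (hζ x')).ne' (div_pos (hν x) (hζ x)).ne'] at hu
    have e : ν x * (ν x' / ζ x' / (ν x / ζ x)) = ν x' * ζ x / ζ x' := by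
      have := (hν x).ne'; have := (hζ x).ne'; have := (hζ x').ne'
      field_simp
    have h2 := mul_le_mul_of_nonneg_left hu (hν x).le
    rw [mul_sub, mul_sub, e] at h2
    have h3 := mul_le_mul_of_nonneg_left h2 (hM.1 x x' hne)
    linarith

/-- Pinsker's inequality with a non-sharp constant: the entropy dominates the squared Hellinger
distance ∑ (√ν - √ζ)², and Cauchy–Schwarz applied to |√ν - √ζ| (√ν + √ζ) does the rest. -/
theorem sq_sum_abs_sub_le_four_mul_realEntropy {ν ζ : X → ℝ} (hν : ∀ x, 0 < ν x)
    (hζ : ∀ x, 0 < ζ x) (hν1 : ∑ x, ν x = 1) (hζ1 : ∑ x, ζ x = 1) :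
    (∑ x, |ν x - ζ x|) ^ 2 ≤ 4 * realEntropy ν ζ := by
  have h1 : ∑ x, (√(ν x) - √(ζ x)) ^ 2 ≤ realEntropy ν ζ := by
    have : realEntropy ν ζ = ∑ x, (ν x * Real.log (ν x / ζ x) - ν x + ζ x) := by
      rw [Finset.sum_add_distrib, Finset.sum_sub_distrib, hν1, hζ1, realEntropy]; ring
    rw [this]
    refine Finset.sum_le_sum fun x _ => ?_
    have ha := Real.sqrt_pos.2 (hν x)
    have hb := Real.sqrt_pos.2 (hζ x)
    have hl := Real.one_sub_inv_le_log_of_pos (div_pos ha hb)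
    have e : Real.log (ν x / ζ x) = 2 * Real.log (√(ν x) / √(ζ x)) := by
      rw [← Real.sqrt_div (hν x).le, Real.log_sqrt (div_pos (hν x) (hζ x)).le]; ring
    have ea := Real.sq_sqrt (hν x).le
    have eb := Real.sq_sqrt (hζ x).le
    rw [e]
    have h2 := mul_le_mul_of_nonneg_left hl (hν x).le
    have e2 : ν x * (1 - (√(ν x) / √(ζ x))⁻¹) = √(ν x) ^ 2 - √(ν x) * √(ζ x) := by
      nth_rw 1 [← ea]; field_simp
    rw [e2] at h2
    nlinarith
  have h2 : ∑ x, (√(ν x) + √(ζ x)) ^ 2 ≤ 4 := by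
    calc ∑ x, (√(ν x) + √(ζ x)) ^ 2 ≤ ∑ x, (2 * ν x + 2 * ζ x) := by
          refine Finset.sum_le_sum fun x _ => ?_
          nlinarith [Real.sq_sqrt (hν x).le, Real.sq_sqrt (hζ x).le,
            sq_nonneg (√(ν x) - √(ζ x))]
      _ = 4 := by
          rw [Finset.sum_add_distrib, ← Finset.mul_sum, ← Finset.mul_sum, hν1, hζ1]; norm_num
  have h3 : ∑ x, |ν x - ζ x| = ∑ x, |√(ν x) - √(ζ x)| * (√(ν x) + √(ζ x)) := by
    refine Finset.sum_congr rfl fun x _ => ?_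
    rw [← abs_of_nonneg (add_nonneg (Real.sqrt_nonneg (ν x)) (Real.sqrt_nonneg (ζ x))),
      ← abs_mul]
    congr 1
    nlinarith [Real.sq_sqrt (hν x).le, Real.sq_sqrt (hζ x).le]
  have h4 := Finset.sum_mul_sq_le_sq_mul_sq Finset.univ
    (fun x => |√(ν x) - √(ζ x)|) (fun x => √(ν x) + √(ζ x))
  simp only [sq_abs] at h4
  rw [h3]
  calc _ ≤ _ := h4
    _ ≤ realEntropy ν ζ * 4 :=
        mul_le_mul h1 h2 (Finset.sum_nonneg fun _ _ => sq_nonneg _)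
          ((Finset.sum_nonneg fun _ _ => sq_nonneg _).trans h1)
    _ = _ := mul_comm _ _

theorem hasDerivWithinAt_realEntropy {p q : ℝ → X → ℝ} {p' q' : X → ℝ} {s : Set ℝ} {t : ℝ}
    (hp : HasDerivWithinAt p p' s t)
    (hq : HasDerivWithinAt q q' s t) (hp0 : ∀ x, 0 < p t x)
    (hq0 : ∀ x, 0 < q t x) :
    HasDerivWithinAt (fun u => realEntropy (p u) (q u))
      (∑ x, (p' x * Real.log (p t x / q t x) + p' x - p t x * q' x / q t x)) s t := by
  unfold realEntropy
  refine HasDerivWithinAt.fun_sum fun x _ => ?_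
  have h1 := hasDerivWithinAt_pi.1 hp x
  have h2 := hasDerivWithinAt_pi.1 hq x
  have h := h1.fun_mul ((h1.fun_div h2 (hq0 x).ne').log (div_pos (hp0 x) (hq0 x)).ne')
  refine h.congr_deriv ?_
  have := (hp0 x).ne'
  have := (hq0 x).ne'
  field_simp
  ring

/-- Rewriting through u log u, continuous at 0, lets `p` have zeros; this is needed at time 0. -/
theorem continuousOn_realEntropy {p : ℝ → X → ℝ} {ζ : X → ℝ} {s : Set ℝ}
    (hp : ContinuousOn p s) (hζ : ∀ x, 0 < ζ x) :
    ContinuousOn (fun t => realEntropy (p t) ζ) s := by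
  have e : (fun t => realEntropy (p t) ζ) =
      fun t => ∑ x, ζ x * ((p t x / ζ x) * Real.log (p t x / ζ x)) := by
    ext t
    refine Finset.sum_congr rfl fun x _ => ?_
    rw [← mul_assoc, mul_div_cancel₀ _ (hζ x).ne']
  rw [e]
  refine continuousOn_finsetSum _ fun x _ => ContinuousOn.mul continuousOn_const ?_
  exact Real.continuous_mul_log.comp_continuousOn
    ((continuousOn_pi.1 hp x).div_const _)

end Entropy

/-! ### Marginals, conditional measures and forward equations -/

theorem sum_filter_fst_eq {Y Z M : Type*} [Fintype Y] [Fintype Z] [DecidableEq Y]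
    [AddCommMonoid M] (y : Y) (f : Y × Z → M) : ∑ x with x.1 = y, f x = ∑ z, f (y, z) := by
  rw [Finset.sum_filter, Fintype.sum_prod_type, Finset.sum_eq_single y]
  · simp
  · intro b _ hb
    simp [hb]
  · simp

theorem marginal_fst {Y Z : Type*} [Fintype Y] [Fintype Z] [DecidableEq Y]
    (ν : Y × Z → ℝ) (y : Y) : marginal Prod.fst ν y = ∑ z, ν (y, z) :=
  sum_filter_fst_eq y ν

theorem sum_marginal_fst {Y Z : Type*} [Fintype Y] [Fintype Z] [DecidableEq Y]
    (ν : Y × Z → ℝ) : ∑ y, marginal Prod.fst ν y = ∑ x, ν x := by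
  simp only [marginal_fst, Fintype.sum_prod_type]

/-- Also true for a null macro-state: division by zero gives 0, and ν vanishes on the whole block.
-/
theorem condMeasure_mul_marginal {Y Z : Type*} [Fintype Y] [Fintype Z] [DecidableEq Y]
    {ν : Y × Z → ℝ} (hν : ∀ x, 0 ≤ ν x) (y : Y) (z : Z) :
    condMeasure Prod.fst ν y (y, z) * marginal Prod.fst ν y = ν (y, z) := by
  unfold condMeasure
  by_cases h : marginal Prod.fst ν y = 0
  · rw [h, mul_zero]
    rw [marginal_fst, Finset.sum_eq_zero_iff_of_nonneg fun z _ => hν (y, z)] at h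
    exact (h z (Finset.mem_univ z)).symm
  · exact div_mul_cancel₀ _ h

theorem IsGenerator.diag_nonpos {X : Type*} [Fintype X] {M : Matrix X X ℝ} (hM : IsGenerator M)
    (x : X) : M x x ≤ 0 := by
  classical
  have h := hM.2 x
  rw [← Finset.add_sum_erase _ _ (Finset.mem_univ x)] at h
  have : 0 ≤ ∑ x' ∈ Finset.univ.erase x, M x x' :=
    Finset.sum_nonneg fun x' hx' => hM.1 x x' (Finset.ne_of_mem_erase hx').symm
  linarith

theorem IsGenerator.diag_mul_le {X : Type*} [Fintype X] {M : Matrix X X ℝ}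
    (hM : IsGenerator M) {p : X → ℝ} (hp : ∀ x, 0 ≤ p x) (x : X) :
    M x x * p x ≤ (Mᵀ *ᵥ p) x := by
  classical
  calc M x x * p x = ∑ x' ∈ {x}, M x' x * p x' := (Finset.sum_singleton _ _).symm
    _ ≤ ∑ x', M x' x * p x' := by
        refine Finset.sum_le_sum_of_subset_of_nonneg (Finset.subset_univ _) fun x' _ hx' => ?_
        exact mul_nonneg (hM.1 x' x fun h => hx' (by simp [h])) (hp x')
    _ = (Mᵀ *ᵥ p) x := rfl

/-- Discarding all inflow except that from `a` leaves a scalar differential inequality, ready for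
`exp_mul_add_le_of_deriv_ge`. -/
theorem IsGenerator.mul_add_diag_mul_le {X : Type*} [Fintype X] {M : Matrix X X ℝ}
    (hM : IsGenerator M) {p : X → ℝ} (hp : ∀ x, 0 ≤ p x) {a x : X} (hax : a ≠ x) :
    M a x * p a + M x x * p x ≤ (Mᵀ *ᵥ p) x := by
  classical
  calc M a x * p a + M x x * p x = ∑ x' ∈ {a, x}, M x' x * p x' := 
        (Finset.sum_pair (f := fun x' => M x' x * p x') hax).symm
    _ ≤ ∑ x', M x' x * p x' := by
        refine Finset.sum_le_sum_of_subset_of_nonneg (Finset.subset_univ _) fun x' _ hx' => ?_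
        have : x' ≠ x := fun h => hx' (by simp [h])
        exact mul_nonneg (hM.1 x' x this) (hp x')
    _ = (Mᵀ *ᵥ p) x := rfl

theorem IsForwardSolution.hasDerivWithinAt_apply {X : Type*} [Fintype X]
    {A : ℝ → Matrix X X ℝ} {T : ℝ} {p : ℝ → X → ℝ} (h : IsForwardSolution A T p) {s t u : ℝ}
    (hs : 0 ≤ s) (ht : t ≤ T) (hu : u ∈ Icc s t) (x : X) :
    HasDerivWithinAt (fun u => p u x) (((A u)ᵀ *ᵥ p u) x) (Icc s t) u :=
  (hasDerivWithinAt_pi.1 (h u ⟨hs.trans hu.1, hu.2.trans ht⟩).2 x).mono (Icc_subset_Icc hs ht)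

theorem IsForwardSolution.nonneg {X : Type*} [Fintype X]
    {A : ℝ → Matrix X X ℝ} {T : ℝ} {p : ℝ → X → ℝ} (h : IsForwardSolution A T p) {t : ℝ}
    (ht : t ∈ Icc 0 T) (x : X) : 0 ≤ p t x := (h t ht).1.1 x

/-! ### Block structure and spreading of mass on the fast time scale -/

section ScaleSeparation

variable {Z : Type*} [Fintype Z]

/-- The total rate of leaving the macro-state `y` from `(y, z)`. -/
def exitRate (G : Fin 2 → Matrix Z Z ℝ) (y : Fin 2) (z : Z) : ℝ := ∑ z', G y z z'

/-- The total rate from `(y, z)` into the macro-state `y'` (on the diagonal, minus the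
rate of leaving `y`). -/
def jumpRate (G : Fin 2 → Matrix Z Z ℝ) (y y' : Fin 2) (z : Z) : ℝ :=
  if y' = y then -exitRate G y z else exitRate G y z

variable [DecidableEq Z] {Q G : Fin 2 → Matrix Z Z ℝ}

theorem scaleGenerator_of_ne (ε : ℝ) {y y' : Fin 2} (h : y' ≠ y) (z z' : Z) :
    scaleGenerator Q G ε (y, z) (y', z') = G y z z' := by
  simp [scaleGenerator, fastPart, slowPart, h]

theorem scaleGenerator_of_ne_right (ε : ℝ) (y : Fin 2) {z z' : Z} (h : z' ≠ z) :
    scaleGenerator Q G ε (y, z) (y, z') = Q y z z' / ε := by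
  simp [scaleGenerator, fastPart, slowPart, h, div_eq_inv_mul]

theorem scaleGenerator_diag (ε : ℝ) (y : Fin 2) (z : Z) :
    scaleGenerator Q G ε (y, z) (y, z) = Q y z z / ε - exitRate G y z := by
  simp [scaleGenerator, fastPart, slowPart, exitRate, div_eq_inv_mul, sub_eq_add_neg]

/-- Fast rows sum to zero inside a block, so ε disappears: this is why macroscopic rates are bounded
uniformly in ε. -/
theorem sum_scaleGenerator (hQ : ∀ y, IsGenerator (Q y)) (ε : ℝ) (y y' : Fin 2) (z : Z) :
    ∑ z', scaleGenerator Q G ε (y, z) (y', z') = jumpRate G y y' z := by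
  unfold jumpRate
  split_ifs with h
  · subst h
    simp [scaleGenerator, fastPart, slowPart, exitRate, Finset.sum_add_distrib,
      ← Finset.mul_sum, (hQ y').2]
  · simp only [scaleGenerator_of_ne ε h, exitRate]

theorem averagedGenerator_fst (hQ : ∀ y, IsGenerator (Q y)) (ε : ℝ) (ν : Fin 2 × Z → ℝ)
    (y y' : Fin 2) : averagedGenerator Prod.fst (scaleGenerator Q G ε) ν y y' =
      ∑ z, jumpRate G y y' z * condMeasure Prod.fst ν y (y, z) := by
  simp only [averagedGenerator, Matrix.of_apply, sum_filter_fst_eq, ← Finset.sum_mul,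
    sum_scaleGenerator hQ]

theorem marginal_transpose_mulVec_apply (hQ : ∀ y, IsGenerator (Q y)) (ε : ℝ)
    (ν : Fin 2 × Z → ℝ) (y : Fin 2) :
    marginal Prod.fst ((scaleGenerator Q G ε)ᵀ *ᵥ ν) y =
      ∑ y', ∑ z, jumpRate G y' y z * ν (y', z) := by
  simp only [marginal_fst _ y, mulVec, dotProduct, transpose_apply]
  rw [Finset.sum_comm, Fintype.sum_prod_type]
  refine Finset.sum_congr rfl fun y' _ => Finset.sum_congr rfl fun z _ => ?_
  rw [← Finset.sum_mul, sum_scaleGenerator hQ]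

/-- Averaging with the conditionals of ν itself closes the equation, since conditional times
marginal gives back ν. -/
theorem marginal_transpose_mulVec (hQ : ∀ y, IsGenerator (Q y)) (ε : ℝ)
    {ν : Fin 2 × Z → ℝ} (hν : ∀ x, 0 ≤ ν x) :
    marginal Prod.fst ((scaleGenerator Q G ε)ᵀ *ᵥ ν) =
      (averagedGenerator Prod.fst (scaleGenerator Q G ε) ν)ᵀ *ᵥ marginal Prod.fst ν := by
  ext y
  simp only [marginal_transpose_mulVec_apply hQ, mulVec, dotProduct, transpose_apply,
    averagedGenerator_fst hQ, Finset.sum_mul, mul_assoc, condMeasure_mul_marginal hν]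

theorem slowRate_nonneg (hL : IsGenerator (scaleGenerator Q G 1)) (y : Fin 2) (z z' : Z) :
    0 ≤ G y z z' := by
  have h : y + 1 ≠ y := by fin_cases y <;> decide
  rw [← scaleGenerator_of_ne (Q := Q) (G := G) 1 h z z']
  exact hL.1 _ _ fun h' => h (congrArg Prod.fst h').symm

theorem exitRate_nonneg (hL : IsGenerator (scaleGenerator Q G 1)) (y : Fin 2) (z : Z) :
    0 ≤ exitRate G y z := Finset.sum_nonneg fun z' _ => slowRate_nonneg hL y z z'

/-- Otherwise the block of `y` would be closed under transitions, contradicting irreducibility. -/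
theorem exists_exitRate_pos [Nonempty Z] (hL : IsIrreducibleGenerator (scaleGenerator Q G 1))
    (y : Fin 2) : ∃ z, 0 < exitRate G y z := by
  by_contra! h
  have h0 : ∀ z z', G y z z' ≤ 0 := fun z z' =>
    (Finset.single_le_sum (fun z' _ => slowRate_nonneg hL.1 y z z') (Finset.mem_univ z')).trans
      (h z)
  obtain ⟨z⟩ := ‹Nonempty Z›
  have key : ∀ x, Relation.ReflTransGen (fun a b => 0 < scaleGenerator Q G 1 a b) (y, z) x →
      x.1 = y := by
    intro x hx
    induction hx with
    | refl => rfl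
    | @tail b c _ hbc ih =>
      by_contra hc
      obtain ⟨b1, b2⟩ := b
      obtain ⟨c1, c2⟩ := c
      obtain rfl : b1 = y := ih
      rw [scaleGenerator_of_ne 1 hc] at hbc
      exact absurd (h0 b2 c2) (not_le.2 hbc)
  have h1 : y + 1 ≠ y := by fin_cases y <;> decide
  exact h1 (key (y + 1, z) (hL.2 _ _))

theorem exists_diag_bound (hL : IsGenerator (scaleGenerator Q G 1)) (ε₀ : ℝ) :
    ∃ K : ℝ, 0 < K ∧ ∀ ε ∈ Ioo 0 ε₀, ∀ x, -scaleGenerator Q G ε x x ≤ K / ε := by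
  obtain ⟨K, hK, h⟩ := exists_ge_of_finite
    fun x : Fin 2 × Z => -Q x.1 x.2 x.2 + ε₀ * exitRate G x.1 x.2
  refine ⟨K, hK, fun ε hε x => ?_⟩
  obtain ⟨y, z⟩ := x
  rw [scaleGenerator_diag, le_div_iff₀ hε.1]
  have h1 := h (y, z)
  have h2 := mul_le_mul_of_nonneg_right hε.2.le (exitRate_nonneg hL y z)
  have h3 : Q y z z / ε * ε = Q y z z := div_mul_cancel₀ _ hε.1.ne'
  simp only at h1
  nlinarith

/-- Along the fast transitions mass spreads in time of order `ε`, uniformly in `ε`. -/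
theorem exists_le_of_reachable (hQ : ∀ y, IsGenerator (Q y))
    (hL : ∀ ε : ℝ, 0 < ε → IsGenerator (scaleGenerator Q G ε)) (ε₀ T : ℝ) {y : Fin 2} {a z : Z}
    (h : Relation.ReflTransGen (fun a b => 0 < Q y a b) a z) :
    ∀ τ : ℝ, 0 < τ → ∃ c : ℝ, 0 < c ∧ ∀ ε ∈ Ioo 0 ε₀, ∀ p : ℝ → Fin 2 × Z → ℝ,
      IsForwardSolution (fun _ => scaleGenerator Q G ε) T p → ∀ s t : ℝ, 0 ≤ s →
      s + ε * τ ≤ t → t ≤ s + ε → t ≤ T → c * p s (y, a) ≤ p t (y, z) := by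
  obtain ⟨K, hK, hKb⟩ := exists_diag_bound (hL 1 one_pos) ε₀
  have hexp : ∀ ε : ℝ, 0 < ε → ∀ d : ℝ, d ≤ ε → Real.exp (-K) ≤ Real.exp (-(K / ε * d)) := by
    intro ε hε d hd
    refine Real.exp_le_exp.2 (neg_le_neg ?_)
    calc K / ε * d ≤ K / ε * ε := mul_le_mul_of_nonneg_left hd (by positivity)
      _ = K := div_mul_cancel₀ _ hε.ne'
  -- Induction along the path, with τ left general so that each further edge can halve the waiting
  -- time.
  induction h with
  | refl =>
    intro τ hτ
    refine ⟨Real.exp (-K), Real.exp_pos _, fun ε hε p hp s t hs hst ht hT => ?_⟩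
    have hst' : s ≤ t := le_trans (by nlinarith [mul_pos hε.1 hτ]) hst
    have h1 := exp_mul_add_le_of_deriv_ge (f := fun u => p u (y, a)) (κ := 0) (Λ := K / ε)
      hst' (by have := hε.1; positivity) le_rfl
      (fun u hu => hp.hasDerivWithinAt_apply hs hT hu (y, a)) (fun u hu => by
        have hu0 : u ∈ Icc 0 T := ⟨hs.trans hu.1, hu.2.trans hT⟩
        have h2 := (hL ε hε.1).diag_mul_le (hp.nonneg hu0) (y, a)
        have h3 := mul_le_mul_of_nonneg_right (hKb ε hε (y, a)) (hp.nonneg hu0 (y, a))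
        linarith)
    rw [zero_mul, add_zero] at h1
    exact (mul_le_mul_of_nonneg_right (hexp ε hε.1 _ (by linarith))
      (hp.nonneg ⟨hs, hst'.trans hT⟩ _)).trans h1
  | @tail b c _ hbc ih =>
    intro τ hτ
    -- After a time ετ/2 the state b is already charged; the rest of the time feeds c through the
    -- edge from b.
    obtain ⟨c₁, hc₁, hc⟩ := ih (τ / 2) (by positivity)
    have hne : b ≠ c := by
      rintro rfl
      exact absurd ((hQ y).diag_nonpos b) (not_le.2 hbc)
    refine ⟨Real.exp (-K) * (Q y b c * c₁ * (τ / 2)), by positivity,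
      fun ε hε p hp s t hs hst ht hT => ?_⟩
    have hε0 := hε.1
    have hετ := mul_pos hε0 hτ
    have hs0 := hp.nonneg (t := s) ⟨hs, by nlinarith⟩ (y, a)
    have hs' : 0 ≤ s + ε * (τ / 2) := by positivity
    have hst' : s + ε * (τ / 2) ≤ t := by nlinarith
    have h1 := exp_mul_add_le_of_deriv_ge (f := fun u => p u (y, c))
      (κ := Q y b c / ε * (c₁ * p s (y, a))) (Λ := K / ε)
      hst' (by positivity) (by positivity)
      (fun u hu => hp.hasDerivWithinAt_apply hs' hT hu (y, c)) (fun u hu => by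
        have hu0 : u ∈ Icc 0 T := ⟨hs'.trans hu.1, hu.2.trans hT⟩
        have h2 := (hL ε hε.1).mul_add_diag_mul_le (hp.nonneg hu0)
          (a := (y, b)) (x := (y, c)) (fun h => hne (congrArg Prod.snd h))
        have h3 := mul_le_mul_of_nonneg_right (hKb ε hε (y, c)) (hp.nonneg hu0 (y, c))
        rw [scaleGenerator_of_ne_right ε y hne.symm] at h2
        have h4 := mul_le_mul_of_nonneg_left
          (hc ε hε p hp s u hs hu.1 (by linarith [hu.2]) hu0.2)
          (show 0 ≤ Q y b c / ε by positivity)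
        linarith)
    refine le_trans ?_ h1
    have h5 : 0 ≤ p (s + ε * (τ / 2)) (y, c) := hp.nonneg ⟨hs', hst'.trans hT⟩ _
    rw [mul_assoc]
    refine mul_le_mul (hexp ε hε0 _ (by linarith)) ?_ (by positivity) (Real.exp_pos _).le
    -- A rate of order 1/ε acting for a time of order ε: the gain does not depend on ε.
    have h6 : Q y b c / ε * (c₁ * p s (y, a)) * (ε * (τ / 2)) =
        Q y b c * c₁ * (τ / 2) * p s (y, a) := by field_simp
    rw [← h6]
    have h7 : Q y b c / ε * (c₁ * p s (y, a)) * (ε * (τ / 2)) ≤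
        Q y b c / ε * (c₁ * p s (y, a)) * (t - (s + ε * (τ / 2))) :=
      mul_le_mul_of_nonneg_left (by nlinarith) (by positivity)
    linarith

/-- In time of order `ε`, the mass of a block spreads over the whole block. -/
theorem exists_marginal_le (hQ : ∀ y, IsIrreducibleGenerator (Q y))
    (hL : ∀ ε : ℝ, 0 < ε → IsGenerator (scaleGenerator Q G ε)) (ε₀ T : ℝ) {τ : ℝ} (hτ : 0 < τ) :
    ∃ c : ℝ, 0 < c ∧ ∀ ε ∈ Ioo 0 ε₀, ∀ p : ℝ → Fin 2 × Z → ℝ,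
      IsForwardSolution (fun _ => scaleGenerator Q G ε) T p → ∀ s t : ℝ, 0 ≤ s →
      s + ε * τ ≤ t → t ≤ s + ε → t ≤ T → ∀ y z, c * marginal Prod.fst (p s) y ≤ p t (y, z) := by
  choose c hc h using fun i : Fin 2 × Z × Z =>
    exists_le_of_reachable (fun y => (hQ y).1) hL ε₀ T ((hQ i.1).2 i.2.1 i.2.2) τ hτ
  obtain ⟨k, hk, hkc⟩ := exists_pos_le_of_finite c hc
  -- Summing over starting points costs a factor |Z|; the extra 1 keeps the denominator positive
  -- even for empty Z.
  refine ⟨k / (Fintype.card Z + 1), by positivity, fun ε hε p hp s t hs hst ht hT y z => ?_⟩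
  have h0 : ∀ x, 0 ≤ p t x := hp.nonneg ⟨by nlinarith [mul_pos hε.1 hτ], hT⟩
  have h0' : ∀ x, 0 ≤ p s x := hp.nonneg ⟨hs, by nlinarith [mul_pos hε.1 hτ]⟩
  have h1 : k * marginal Prod.fst (p s) y ≤ Fintype.card Z * p t (y, z) := by
    rw [marginal_fst, Finset.mul_sum, ← nsmul_eq_mul, ← Finset.card_univ, ← Finset.sum_const]
    exact Finset.sum_le_sum fun a _ =>
      (mul_le_mul_of_nonneg_right (hkc (y, a, z)) (h0' _)).trans
        (h (y, a, z) ε hε p hp s t hs hst ht hT)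
  rw [div_mul_eq_mul_div, div_le_iff₀ (by positivity)]
  nlinarith [h0 (y, z)]

end ScaleSeparation

/-! ### Lower bounds uniform in ε, and the equation of the marginals -/

section ScaleSeparation

variable {Z : Type*} [Fintype Z] {Q G : Fin 2 → Matrix Z Z ℝ}

theorem add_one_ne_self (y : Fin 2) : y + 1 ≠ y := by
  revert y
  decide

theorem univ_eq_pair_of_ne {y y' : Fin 2} (h : y' ≠ y) :
    (Finset.univ : Finset (Fin 2)) = {y', y} := by
  revert y y'
  decide

theorem exists_abs_jumpRate_le (G : Fin 2 → Matrix Z Z ℝ) :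
    ∃ Λ : ℝ, 0 < Λ ∧ ∀ y y' z, |jumpRate G y y' z| ≤ Λ := by
  obtain ⟨Λ, hΛ, h⟩ := exists_ge_of_finite
    fun i : Fin 2 × Fin 2 × Z => |jumpRate G i.1 i.2.1 i.2.2|
  exact ⟨Λ, hΛ, fun y y' z => h (y, y', z)⟩

theorem IsForwardSolution.hasDerivWithinAt_marginal {A : ℝ → Matrix (Fin 2 × Z) (Fin 2 × Z) ℝ}
    {T : ℝ} {p : ℝ → Fin 2 × Z → ℝ} (h : IsForwardSolution A T p) {s t u : ℝ}
    (hs : 0 ≤ s) (ht : t ≤ T) (hu : u ∈ Icc s t) (y : Fin 2) :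
    HasDerivWithinAt (fun u => marginal Prod.fst (p u) y)
      (marginal Prod.fst ((A u)ᵀ *ᵥ p u) y) (Icc s t) u := by
  simp only [marginal_fst]
  exact HasDerivWithinAt.fun_sum fun z _ => h.hasDerivWithinAt_apply hs ht hu (y, z)

theorem le_marginal {ν : Fin 2 × Z → ℝ} (hν : ∀ x, 0 ≤ ν x) (y : Fin 2) (z : Z) :
    ν (y, z) ≤ marginal Prod.fst ν y := by
  rw [marginal_fst]
  exact Finset.single_le_sum (f := fun z => ν (y, z)) (fun z _ => hν _) (Finset.mem_univ z)

theorem marginal_fst_nonneg {ν : Fin 2 × Z → ℝ} (hν : ∀ x, 0 ≤ ν x) (y : Fin 2) :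
    0 ≤ marginal Prod.fst ν y := Finset.sum_nonneg fun x _ => hν x

theorem marginal_fst_mem_stdSimplex {ν : Fin 2 × Z → ℝ} (hν : ν ∈ stdSimplex ℝ (Fin 2 × Z)) :
    marginal Prod.fst ν ∈ stdSimplex ℝ (Fin 2) :=
  ⟨marginal_fst_nonneg hν.1, by rw [sum_marginal_fst, hν.2]⟩

theorem exists_half_le {ν : Fin 2 → ℝ} (hν : ν ∈ stdSimplex ℝ (Fin 2)) :
    ∃ y, 1 / 2 ≤ ν y := by
  by_contra! h
  have := hν.2
  rw [Fin.sum_univ_two] at this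
  linarith [h 0, h 1]

theorem sum_condMeasure_fst {ν : Fin 2 × Z → ℝ} {y : Fin 2} (h : 0 < marginal Prod.fst ν y) :
    ∑ z, condMeasure Prod.fst ν y (y, z) = 1 := by
  simp only [condMeasure]
  rw [← Finset.sum_div, ← marginal_fst, div_self h.ne']

variable [DecidableEq Z]

/-- Only the inflow from the single state (y', z) is kept, while the outflow rate is at most Λ. -/
theorem le_marginal_transpose_mulVec (hQ : ∀ y, IsGenerator (Q y))
    (hL : IsGenerator (scaleGenerator Q G 1)) (ε : ℝ) {Λ : ℝ}
    (hΛ : ∀ y y' z, |jumpRate G y y' z| ≤ Λ) {ν : Fin 2 × Z → ℝ} (hν : ∀ x, 0 ≤ ν x)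
    {y y' : Fin 2} (h : y' ≠ y) (z : Z) :
    exitRate G y' z * ν (y', z) - Λ * marginal Prod.fst ν y ≤
      marginal Prod.fst ((scaleGenerator Q G ε)ᵀ *ᵥ ν) y := by
  rw [marginal_transpose_mulVec_apply hQ, univ_eq_pair_of_ne h, Finset.sum_pair h, marginal_fst,
    Finset.mul_sum]
  have h1 : exitRate G y' z * ν (y', z) ≤ ∑ z, jumpRate G y' y z * ν (y', z) := by
    simp only [jumpRate, if_neg h.symm]
    exact Finset.single_le_sum (f := fun z => exitRate G y' z * ν (y', z))
      (fun z _ => mul_nonneg (exitRate_nonneg hL y' z) (hν _)) (Finset.mem_univ z)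
  have h2 : -∑ z, Λ * ν (y, z) ≤ ∑ z, jumpRate G y y z * ν (y, z) := by
    rw [← Finset.sum_neg_distrib]
    refine Finset.sum_le_sum fun z _ => ?_
    nlinarith [neg_le_of_abs_le (hΛ y y z), hν (y, z)]
  linarith

/-- A lower bound for the masses of the macro-states at positive times. -/
theorem exists_le_marginal [Nonempty Z] (hQ : ∀ y, IsIrreducibleGenerator (Q y))
    (hL : ∀ ε : ℝ, 0 < ε → IsIrreducibleGenerator (scaleGenerator Q G ε)) {ε₀ T δ : ℝ}
    (hε₀ : 0 < ε₀) (hδ : 0 < δ) (hδT : δ ≤ T) :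
    ∃ k : ℝ, 0 < k ∧ ∀ ε ∈ Ioo 0 ε₀, ∀ p : ℝ → Fin 2 × Z → ℝ,
      IsForwardSolution (fun _ => scaleGenerator Q G ε) T p → ∀ t ∈ Icc δ T, ∀ y,
      k ≤ marginal Prod.fst (p t) y := by
  have hT : 0 < T := hδ.trans_le hδT
  have hQ' : ∀ y, IsGenerator (Q y) := fun y => (hQ y).1
  have hL1 := (hL 1 one_pos).1
  obtain ⟨Λ, hΛ, hΛb⟩ := exists_abs_jumpRate_le G
  -- For every ε < ε₀ the spreading time ετ then fits both into ε and into δ/2.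
  have hτ : 0 < min 1 (δ / 2 / ε₀) := by positivity
  obtain ⟨k₁, hk₁, h₁⟩ := exists_marginal_le hQ (fun ε hε => (hL ε hε).1) ε₀ T hτ
  choose zs hzs using exists_exitRate_pos (hL 1 one_pos)
  obtain ⟨g, hg, hgz⟩ := exists_pos_le_of_finite _ hzs
  have hexp : ∀ s t : ℝ, 0 ≤ s → s ≤ t → t ≤ T →
      Real.exp (-(Λ * T)) ≤ Real.exp (-(Λ * (t - s))) := fun s t hs _ ht =>
    Real.exp_le_exp.2 (neg_le_neg (mul_le_mul_of_nonneg_left (by linarith) hΛ.le))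
  set E := Real.exp (-(Λ * T)) with hE
  have hE0 : 0 < E := Real.exp_pos _
  refine ⟨min (E * (1 / 2)) (E * (g * (k₁ * (E * (1 / 2))) * (δ / 2))), by positivity,
    fun ε hε p hp t ht => ?_⟩
  -- One macro-state starts with at least half the mass and loses it at rate at most Λ; which one
  -- may depend on ε, but the bound does not.
  obtain ⟨y₀, hy₀⟩ := exists_half_le (marginal_fst_mem_stdSimplex (hp 0 ⟨le_rfl, hT.le⟩).1)
  have hmass : ∀ u ∈ Icc 0 T, E * (1 / 2) ≤ marginal Prod.fst (p u) y₀ := by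
    intro u hu
    have h := exp_mul_add_le_of_deriv_ge (κ := 0) hu.1 hΛ.le le_rfl
      (fun v hv => hp.hasDerivWithinAt_marginal le_rfl hu.2 hv y₀) (fun v hv => by
        have hv0 := hp.nonneg ⟨hv.1, hv.2.trans hu.2⟩
        have hne : y₀ + 1 ≠ y₀ := add_one_ne_self y₀
        have := le_marginal_transpose_mulVec hQ' hL1 ε hΛb hv0 hne (zs (y₀ + 1))
        have := mul_nonneg (hzs (y₀ + 1)).le (hv0 (y₀ + 1, zs (y₀ + 1)))
        linarith)
    rw [zero_mul, add_zero] at h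
    exact (mul_le_mul (hexp 0 u le_rfl hu.1 hu.2) hy₀ (by norm_num) (Real.exp_pos _).le).trans h
  have hfill : ∀ u ∈ Icc (δ / 2) T, ∀ z, k₁ * (E * (1 / 2)) ≤ p u (y₀, z) := by
    intro u hu z
    have hτ1 : ε * min 1 (δ / 2 / ε₀) ≤ ε :=
      mul_le_of_le_one_right hε.1.le (min_le_left _ _)
    have hτ2 : ε * min 1 (δ / 2 / ε₀) ≤ δ / 2 := by
      calc ε * min 1 (δ / 2 / ε₀) ≤ ε₀ * (δ / 2 / ε₀) :=
            mul_le_mul hε.2.le (min_le_right _ _) hτ.le hε₀.le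
        _ = δ / 2 := mul_div_cancel₀ _ hε₀.ne'
    have hτ3 := mul_pos hε.1 hτ
    have hs : 0 ≤ u - ε * min 1 (δ / 2 / ε₀) := by linarith [hu.1]
    refine le_trans (mul_le_mul_of_nonneg_left (hmass _ ⟨hs, by linarith [hu.2]⟩) hk₁.le)
      (h₁ ε hε p hp _ u hs (by linarith) (by linarith) hu.2 y₀ z)
  intro y
  by_cases hy : y₀ = y
  · subst hy
    exact (min_le_left _ _).trans (hmass t ⟨hδ.le.trans ht.1, ht.2⟩)
  · refine (min_le_right _ _).trans ?_
    have hδ2 : 0 ≤ δ / 2 := by positivity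
    have hδt : δ / 2 ≤ t := by linarith [ht.1]
    -- From time δ/2 on the block of y₀ is filled, so a state with positive exit rate feeds y for a
    -- time at least δ/2.
    have h := exp_mul_add_le_of_deriv_ge (κ := g * (k₁ * (E * (1 / 2)))) hδt hΛ.le
      (by positivity) (fun v hv => hp.hasDerivWithinAt_marginal hδ2 ht.2 hv y) (fun v hv => by
        have hv0 := hp.nonneg ⟨hδ2.trans hv.1, hv.2.trans ht.2⟩
        have h1 := le_marginal_transpose_mulVec hQ' hL1 ε hΛb hv0 hy (zs y₀)
        have h2 := mul_le_mul (hgz y₀) (hfill v ⟨hv.1, hv.2.trans ht.2⟩ (zs y₀))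
          (by positivity) (hzs y₀).le
        linarith)
    refine le_trans (mul_le_mul (hexp _ t hδ2 hδt ht.2) ?_ (by positivity) (Real.exp_pos _).le) h
    have h3 : 0 ≤ marginal Prod.fst (p (δ / 2)) y :=
      marginal_fst_nonneg (hp.nonneg ⟨hδ2, hδt.trans ht.2⟩) y
    have h4 : g * (k₁ * (E * (1 / 2))) * (δ / 2) ≤ g * (k₁ * (E * (1 / 2))) * (t - δ / 2) :=
      mul_le_mul_of_nonneg_left (by linarith [ht.1]) (by positivity)
    linarith

/-- A lower bound for the probabilities at positive times, uniform in `ε`. -/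
theorem exists_le_apply [Nonempty Z] (hQ : ∀ y, IsIrreducibleGenerator (Q y))
    (hL : ∀ ε : ℝ, 0 < ε → IsIrreducibleGenerator (scaleGenerator Q G ε)) {ε₀ T δ : ℝ}
    (hε₀ : 0 < ε₀) (hδ : 0 < δ) (hδT : δ ≤ T) :
    ∃ k : ℝ, 0 < k ∧ ∀ ε ∈ Ioo 0 ε₀, ∀ p : ℝ → Fin 2 × Z → ℝ,
      IsForwardSolution (fun _ => scaleGenerator Q G ε) T p → ∀ t ∈ Icc δ T, ∀ x,
      k ≤ p t x := by
  have hτ : 0 < min 1 (δ / 2 / ε₀) := by positivity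
  obtain ⟨k₁, hk₁, h₁⟩ := exists_marginal_le hQ (fun ε hε => (hL ε hε).1) ε₀ T hτ
  -- Marginals are bounded below from time δ/2; the remaining δ/2 leaves room for the spreading
  -- inside blocks.
  obtain ⟨k₂, hk₂, h₂⟩ := exists_le_marginal hQ hL hε₀ (half_pos hδ) ((half_le_self hδ.le).trans hδT)
  refine ⟨k₁ * k₂, by positivity, fun ε hε p hp t ht x => ?_⟩
  have hτ1 : ε * min 1 (δ / 2 / ε₀) ≤ ε := mul_le_of_le_one_right hε.1.le (min_le_left _ _)
  have hτ2 : ε * min 1 (δ / 2 / ε₀) ≤ δ / 2 := by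
    calc ε * min 1 (δ / 2 / ε₀) ≤ ε₀ * (δ / 2 / ε₀) :=
          mul_le_mul hε.2.le (min_le_right _ _) hτ.le hε₀.le
      _ = δ / 2 := mul_div_cancel₀ _ hε₀.ne'
  have hτ3 := mul_pos hε.1 hτ
  have hs : δ / 2 ≤ t - ε * min 1 (δ / 2 / ε₀) := by linarith [ht.1]
  exact (mul_le_mul_of_nonneg_left (h₂ ε hε p hp _ ⟨hs, by linarith [ht.2]⟩ x.1) hk₁.le).trans
    (h₁ ε hε p hp _ t (by linarith) (by linarith) (by linarith) ht.2 x.1 x.2)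

/-- As a constant solution, ρ inherits every lower bound proved for solutions. -/
theorem IsStationaryMeasure.isForwardSolution {X : Type*} [Fintype X] {M : Matrix X X ℝ}
    {ζ : X → ℝ} (h : IsStationaryMeasure M ζ) (T : ℝ) :
    IsForwardSolution (fun _ => M) T (fun _ => ζ) := by
  refine fun t _ => ⟨h.1, ?_⟩
  simp only [h.2]
  exact hasDerivWithinAt_const _ _ _

theorem abs_averagedGenerator_le (hQ : ∀ y, IsGenerator (Q y)) (ε : ℝ) {Λ : ℝ}
    (hΛ0 : 0 ≤ Λ) (hΛ : ∀ y y' z, |jumpRate G y y' z| ≤ Λ) {ν : Fin 2 × Z → ℝ}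
    (hν : ∀ x, 0 ≤ ν x) (y y' : Fin 2) :
    |averagedGenerator Prod.fst (scaleGenerator Q G ε) ν y y'| ≤ Λ := by
  rw [averagedGenerator_fst hQ]
  have hm := marginal_fst_nonneg hν y
  have hc : ∀ z, 0 ≤ condMeasure Prod.fst ν y (y, z) := fun z => div_nonneg (hν _) hm
  have hs : ∑ z, condMeasure Prod.fst ν y (y, z) ≤ 1 := by
    rcases hm.eq_or_lt with h | h
    · simp [condMeasure, ← h]
    · exact (sum_condMeasure_fst h).le
  calc |∑ z, jumpRate G y y' z * condMeasure Prod.fst ν y (y, z)|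
      ≤ ∑ z, Λ * condMeasure Prod.fst ν y (y, z) := by
        refine (Finset.abs_sum_le_sum_abs _ _).trans (Finset.sum_le_sum fun z _ => ?_)
        rw [abs_mul, abs_of_nonneg (hc z)]
        exact mul_le_mul_of_nonneg_right (hΛ _ _ _) (hc z)
    _ ≤ Λ := by
        rw [← Finset.mul_sum]
        exact mul_le_of_le_one_right hΛ0 hs

theorem averagedGenerator_isGenerator (hQ : ∀ y, IsGenerator (Q y))
    (hL : IsGenerator (scaleGenerator Q G 1)) (ε : ℝ) {ν : Fin 2 × Z → ℝ} (hν : ∀ x, 0 ≤ ν x) :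
    IsGenerator (averagedGenerator Prod.fst (scaleGenerator Q G ε) ν) := by
  refine ⟨fun y y' h => ?_, fun y => ?_⟩
  · rw [averagedGenerator_fst hQ]
    refine Finset.sum_nonneg fun z _ => mul_nonneg ?_
      (div_nonneg (hν _) (marginal_fst_nonneg hν y))
    rw [jumpRate, if_neg h.symm]
    exact exitRate_nonneg hL y z
  · simp only [averagedGenerator_fst hQ]
    rw [Finset.sum_comm]
    refine Finset.sum_eq_zero fun z _ => ?_
    rw [← Finset.sum_mul]
    have h : y + 1 ≠ y := add_one_ne_self y
    rw [univ_eq_pair_of_ne h, Finset.sum_pair h]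
    simp [jumpRate]

/-- A lower bound for the effective dynamics at positive times, uniform in `ε`. -/
theorem exists_le_effective [Nonempty Z] (hQ : ∀ y, IsIrreducibleGenerator (Q y))
    (hL : ∀ ε : ℝ, 0 < ε → IsIrreducibleGenerator (scaleGenerator Q G ε)) {ε₀ T δ : ℝ}
    (hε₀ : 0 < ε₀) (hδ : 0 < δ) (hδT : δ ≤ T) :
    ∃ k : ℝ, 0 < k ∧ ∀ ε ∈ Ioo 0 ε₀, ∀ ρ : Fin 2 × Z → ℝ,
      IsStationaryMeasure (scaleGenerator Q G ε) ρ → ∀ η : ℝ → Fin 2 → ℝ,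
      IsEffective Prod.fst (scaleGenerator Q G ε) T ρ η → ∀ t ∈ Icc δ T, ∀ y, k ≤ η t y := by
  have hQ' : ∀ y, IsGenerator (Q y) := fun y => (hQ y).1
  have hL1 := (hL 1 one_pos).1
  obtain ⟨Λ, hΛ, hΛb⟩ := exists_abs_jumpRate_le G
  obtain ⟨k, hk, hkb⟩ := exists_le_apply hQ hL hε₀ hδ hδT
  choose zs hzs using exists_exitRate_pos (hL 1 one_pos)
  obtain ⟨g, hg, hgz⟩ := exists_pos_le_of_finite _ hzs
  refine ⟨Real.exp (-((g * k + Λ) * T)) * (g * k * δ), by positivity,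
    fun ε hε ρ hρ η hη t ht y => ?_⟩
  have hρ0 : ∀ x, k ≤ ρ x := hkb ε hε _ (hρ.isForwardSolution T) δ ⟨le_rfl, hδT⟩
  have hρn : ∀ x, 0 ≤ ρ x := hρ.1.1
  have hN := averagedGenerator_isGenerator hQ' hL1 ε hρn
  have hrate : ∀ y y' : Fin 2, y ≠ y' →
      g * k ≤ averagedGenerator Prod.fst (scaleGenerator Q G ε) ρ y y' := by
    intro y y' h
    have hpos : 0 < marginal Prod.fst ρ y :=
      (hk.trans_le (hρ0 (y, zs y))).trans_le (le_marginal hρn y (zs y))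
    have hle : marginal Prod.fst ρ y ≤ 1 := by
      rw [← (marginal_fst_mem_stdSimplex hρ.1).2]
      exact Finset.single_le_sum (fun y _ => marginal_fst_nonneg hρn y) (Finset.mem_univ y)
    rw [averagedGenerator_fst hQ']
    simp only [jumpRate, if_neg h.symm]
    refine le_trans ?_ (Finset.single_le_sum
      (f := fun z => exitRate G y z * condMeasure Prod.fst ρ y (y, z))
      (fun z _ => mul_nonneg (exitRate_nonneg hL1 y z) (div_nonneg (hρn _) hpos.le))
      (Finset.mem_univ (zs y)))
    refine mul_le_mul (hgz y) ?_ hk.le (hzs y).le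
    exact (hρ0 (y, zs y)).trans (le_div_self (hρn _) hpos hle)
  have ht0 : 0 ≤ t := hδ.le.trans ht.1
  -- With total mass 1, inflow at least gk(1 - η) and outflow at most Λη give η' ≥ gk - (gk + Λ)η.
  have h := exp_mul_add_le_of_deriv_ge (κ := g * k) (Λ := g * k + Λ) (f := fun u => η u y)
    ht0 (by positivity) (by positivity)
    (fun v hv => hη.hasDerivWithinAt_apply le_rfl ht.2 hv y) (fun v hv => by
      have hv0 := hη.nonneg ⟨hv.1, hv.2.trans ht.2⟩
      have hne : y + 1 ≠ y := add_one_ne_self y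
      have h1 := hN.mul_add_diag_mul_le hv0 hne
      have h2 := (hη v ⟨hv.1, hv.2.trans ht.2⟩).1.2
      rw [univ_eq_pair_of_ne hne, Finset.sum_pair hne] at h2
      have h3 := mul_le_mul_of_nonneg_right (hrate _ _ hne) (hv0 (y + 1))
      have h4 := mul_le_mul_of_nonneg_right
        (neg_le_of_abs_le (abs_averagedGenerator_le hQ' ε hΛ.le hΛb hρn y y)) (hv0 y)
      have h5 : η v (y + 1) = 1 - η v y := by linarith
      rw [h5] at h3 h1
      linarith)
  refine le_trans (mul_le_mul ?_ ?_ (by positivity) (Real.exp_pos _).le) h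
  · exact Real.exp_le_exp.2 (neg_le_neg
      (mul_le_mul_of_nonneg_left (by linarith [ht.2]) (by positivity)))
  · have h6 := hη.nonneg (t := 0) ⟨le_rfl, ht0.trans ht.2⟩ y
    have h7 : g * k * δ ≤ g * k * (t - 0) :=
      mul_le_mul_of_nonneg_left (by linarith [ht.1]) (by positivity)
    linarith

/-- The coarse-grained dynamics is the curve of marginals. -/
theorem IsCoarseGrained.eq_marginal (hQ : ∀ y, IsGenerator (Q y)) {ε T : ℝ}
    {μ : ℝ → Fin 2 × Z → ℝ} {m : ℝ → Fin 2 → ℝ}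
    (hμ : IsForwardSolution (fun _ => scaleGenerator Q G ε) T μ)
    (hm : IsCoarseGrained Prod.fst (scaleGenerator Q G ε) T μ m) {t : ℝ} (ht : t ∈ Icc 0 T) :
    m t = marginal Prod.fst (μ t) := by
  obtain ⟨Λ, hΛ, hΛb⟩ := exists_abs_jumpRate_le G
  have hv : ∀ t ∈ Ico 0 T, LipschitzOnWith (Real.toNNReal (2 * Λ))
      (fun p : Fin 2 → ℝ => (averagedGenerator Prod.fst (scaleGenerator Q G ε) (μ t))ᵀ *ᵥ p)
      univ := by
    intro t ht
    refine LipschitzOnWith.of_dist_le_mul fun p _ q _ => ?_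
    rw [Real.coe_toNNReal _ (by positivity), dist_pi_le_iff (by positivity)]
    intro y
    rw [Real.dist_eq]
    simp only [mulVec, dotProduct, transpose_apply]
    rw [← Finset.sum_sub_distrib]
    calc |∑ y', _| ≤ ∑ y' : Fin 2, Λ * dist p q := by
          refine (Finset.abs_sum_le_sum_abs _ _).trans (Finset.sum_le_sum fun y' _ => ?_)
          rw [← mul_sub, abs_mul]
          exact mul_le_mul (abs_averagedGenerator_le hQ ε hΛ.le hΛb
            (hμ.nonneg (Ico_subset_Icc_self ht)) _ _) (dist_le_pi_dist p q y')
            (abs_nonneg _) hΛ.le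
      _ = 2 * Λ * dist p q := by simp; ring
  have hmem : ∀ t ∈ Ico 0 T, Icc 0 T ∈ 𝓝[≥] t := fun t ht =>
    mem_of_superset (Icc_mem_nhdsGE ht.2) (Icc_subset_Icc_left ht.1)
  have hμm : ∀ t ∈ Icc 0 T, HasDerivWithinAt (fun t => marginal Prod.fst (μ t))
      ((averagedGenerator Prod.fst (scaleGenerator Q G ε) (μ t))ᵀ *ᵥ marginal Prod.fst (μ t))
      (Icc 0 T) t := by
    intro t ht
    rw [← marginal_transpose_mulVec hQ ε (hμ.nonneg ht)]
    exact hasDerivWithinAt_pi.2 fun y => hμ.hasDerivWithinAt_marginal le_rfl le_rfl ht y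
  -- Both curves solve one linear equation, whose coefficients are fixed by μ and bounded by Λ.
  exact ODE_solution_unique_of_mem_Icc_right hv
    (fun t ht => (hm.1 t ht).2.continuousWithinAt)
    (fun t ht => (hm.1 t (Ico_subset_Icc_self ht)).2.mono_of_mem_nhdsWithin (hmem t ht))
    (fun _ _ => mem_univ _)
    (fun t ht => (hμm t ht).continuousWithinAt)
    (fun t ht => (hμm t (Ico_subset_Icc_self ht)).mono_of_mem_nhdsWithin (hmem t ht))
    (fun _ _ => mem_univ _) hm.2 ht

end ScaleSeparation

/-! ### Entropy dissipation along the forward equation -/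

section Dissipation

variable {X : Type*} [Fintype X]

theorem sum_transpose_mulVec_mul (M : Matrix X X ℝ) (ν f : X → ℝ) :
    ∑ x, (Mᵀ *ᵥ ν) x * f x = ∑ x, ∑ x', M x x' * ν x * f x' := by
  simp only [mulVec, dotProduct, transpose_apply, Finset.sum_mul]
  exact Finset.sum_comm

theorem sum_transpose_mulVec {M : Matrix X X ℝ} (hM : IsGenerator M) (ν : X → ℝ) :
    ∑ x, (Mᵀ *ᵥ ν) x = 0 := by
  have h := sum_transpose_mulVec_mul M ν 1
  simp only [Pi.one_apply, mul_one] at h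
  rw [h]
  exact Finset.sum_eq_zero fun x _ => by rw [← Finset.sum_mul, hM.2 x, zero_mul]

/-- Neither measure has to be stationary: the motion of ζ supplies the quotient term of the Fisher
information. It serves both for `μ` against `ρ` and for the marginal against the moving `η`. -/
theorem sum_entropy_production_eq {M : Matrix X X ℝ} (hM : IsGenerator M) (ν ζ : X → ℝ) :
    ∑ x, ((Mᵀ *ᵥ ν) x * Real.log (ν x / ζ x) + (Mᵀ *ᵥ ν) x - ν x * (Mᵀ *ᵥ ζ) x / ζ x) =
      -realFisherInfo M ν ζ := by
  have h1 : ∑ x, ν x * (Mᵀ *ᵥ ζ) x / ζ x = ∑ x, (Mᵀ *ᵥ ζ) x * (ν x / ζ x) :=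
    Finset.sum_congr rfl fun x _ => by ring
  rw [Finset.sum_sub_distrib, Finset.sum_add_distrib, sum_transpose_mulVec hM, add_zero, h1,
    sum_transpose_mulVec_mul, sum_transpose_mulVec_mul, realFisherInfo,
    ← Finset.sum_sub_distrib, ← Finset.sum_neg_distrib]
  refine Finset.sum_congr rfl fun x _ => ?_
  rw [← Finset.sum_sub_distrib, ← Finset.sum_neg_distrib]
  exact Finset.sum_congr rfl fun x' _ => by ring

theorem realFisherInfo_smul_add (c : ℝ) (A B : Matrix X X ℝ) (ν ζ : X → ℝ) :
    realFisherInfo (c • A + B) ν ζ = c * realFisherInfo A ν ζ + realFisherInfo B ν ζ := by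
  simp only [realFisherInfo, Finset.mul_sum]
  rw [← Finset.sum_add_distrib]
  refine Finset.sum_congr rfl fun x _ => ?_
  rw [← Finset.sum_add_distrib]
  refine Finset.sum_congr rfl fun x' _ => ?_
  simp only [Matrix.add_apply, Matrix.smul_apply, smul_eq_mul]
  ring

/-- The constant log(a/b) is killed by the zero row sums. This passes from a measure restricted to a
block to its normalised conditional. -/
theorem realFisherInfo_const_mul {M : Matrix X X ℝ} (hM : IsGenerator M) {ν ζ : X → ℝ}
    (hν : ∀ x, 0 < ν x) (hζ : ∀ x, 0 < ζ x) {a b : ℝ} (ha : 0 < a) (hb : 0 < b) :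
    realFisherInfo M (fun x => ν x * a) (fun x => ζ x * b) = a * realFisherInfo M ν ζ := by
  simp only [realFisherInfo, Finset.mul_sum]
  refine Finset.sum_congr rfl fun x _ => ?_
  have h0 : ∑ x', M x x' * (Real.log (a / b) * (ν x * a)) = 0 := by
    rw [← Finset.sum_mul, hM.2 x, zero_mul]
  rw [← add_zero (∑ x', (-(M x x' * Real.log (ν x' * a / (ζ x' * b))) * (ν x * a) +
    M x x' * (ν x' * a * (ζ x * b) / (ζ x' * b)))), ← h0, ← Finset.sum_add_distrib]
  refine Finset.sum_congr rfl fun x' _ => ?_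
  rw [mul_div_mul_comm, Real.log_mul (div_pos (hν x') (hζ x')).ne' (div_pos ha hb).ne']
  have := (hζ x').ne'
  field_simp
  ring

/-- The relative entropy of two solutions of the same equation dissipates at the rate of the
Fisher information. -/
theorem hasDerivWithinAt_realEntropy_solution {M : Matrix X X ℝ} (hM : IsGenerator M) {T t : ℝ}
    {p q : ℝ → X → ℝ} (hp : IsForwardSolution (fun _ => M) T p)
    (hq : IsForwardSolution (fun _ => M) T q) (ht : t ∈ Icc 0 T) (hp0 : ∀ x, 0 < p t x)
    (hq0 : ∀ x, 0 < q t x) :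
    HasDerivWithinAt (fun u => realEntropy (p u) (q u)) (-realFisherInfo M (p t) (q t))
      (Icc 0 T) t := by
  rw [← sum_entropy_production_eq hM]
  exact hasDerivWithinAt_realEntropy (hp t ht).2 (hq t ht).2 hp0 hq0

/-- Positivity is required only at interior times, as the initial datum may have zeros; continuity
covers the end points. -/
theorem antitoneOn_realEntropy {M : Matrix X X ℝ} (hM : IsGenerator M) {T : ℝ}
    {p : ℝ → X → ℝ} {ζ : X → ℝ} (hp : IsForwardSolution (fun _ => M) T p)
    (hζ : IsStationaryMeasure M ζ) (hζ0 : ∀ x, 0 < ζ x)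
    (hp0 : ∀ t ∈ Ioo 0 T, ∀ x, 0 < p t x) :
    AntitoneOn (fun t => realEntropy (p t) ζ) (Icc 0 T) := by
  have hi : interior (Icc 0 T) ⊆ Icc 0 T := interior_subset
  refine antitoneOn_of_hasDerivWithinAt_nonpos (convex_Icc 0 T)
    (continuousOn_realEntropy (fun t ht => (hp t ht).2.continuousWithinAt) hζ0)
    (fun t ht => (hasDerivWithinAt_realEntropy_solution hM hp (hζ.isForwardSolution T) (hi ht)
      (hp0 t (by rwa [interior_Icc] at ht)) hζ0).mono hi) fun t ht => ?_
  exact neg_nonpos.2 (realFisherInfo_nonneg hM (hp0 t (by rwa [interior_Icc] at ht)) hζ0)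

end Dissipation

/-! ### Fast Fisher information and the coarse-graining error -/

section ScaleSeparation

variable {Z : Type*} [Fintype Z] {Q G : Fin 2 → Matrix Z Z ℝ}

theorem condMeasure_fst_pos {ν : Fin 2 × Z → ℝ} (hν : ∀ x, 0 < ν x) {y : Fin 2}
    (h : 0 < marginal Prod.fst ν y) (z : Z) : 0 < condMeasure Prod.fst ν y (y, z) :=
  div_pos (hν _) h

theorem realFisherInfo_fastPart (hQ : ∀ y, IsGenerator (Q y)) {ν ζ : Fin 2 × Z → ℝ}
    (hν : ∀ x, 0 < ν x) (hζ : ∀ x, 0 < ζ x) :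
    realFisherInfo (fastPart Q) ν ζ = ∑ y, marginal Prod.fst ν y *
      realFisherInfo (Q y) (fun z => condMeasure Prod.fst ν y (y, z))
        (fun z => condMeasure Prod.fst ζ y (y, z)) := by
  rw [realFisherInfo, Fintype.sum_prod_type]
  refine Finset.sum_congr rfl fun y _ => ?_
  rcases isEmpty_or_nonempty Z with hZ | ⟨⟨z₀⟩⟩
  · simp [realFisherInfo]
  have hmν : 0 < marginal Prod.fst ν y :=
    (hν (y, z₀)).trans_le (le_marginal (fun x => (hν x).le) y z₀)
  have hmζ : 0 < marginal Prod.fst ζ y :=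
    (hζ (y, z₀)).trans_le (le_marginal (fun x => (hζ x).le) y z₀)
  rw [← realFisherInfo_const_mul (hQ y) (condMeasure_fst_pos hν hmν)
    (condMeasure_fst_pos hζ hmζ) hmν hmζ]
  simp only [condMeasure_mul_marginal fun x => (hν x).le,
    condMeasure_mul_marginal fun x => (hζ x).le]
  refine Finset.sum_congr rfl fun z _ => ?_
  rw [Fintype.sum_prod_type, Finset.sum_eq_single y]
  · simp [fastPart]
  · intro y' _ h
    simp [fastPart, h]
  · simp

theorem realEntropy_condMeasure_le {α : ℝ} {y : Fin 2} {ν ζ : Fin 2 × Z → ℝ} {M : Matrix Z Z ℝ}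
    (h : LogSobolev α M (fun z => condMeasure Prod.fst ζ y (y, z)))
    (hν : ∀ x, 0 < ν x) (hζ : ∀ x, 0 < ζ x) (hmν : 0 < marginal Prod.fst ν y)
    (hmζ : 0 < marginal Prod.fst ζ y) :
    realEntropy (fun z => condMeasure Prod.fst ν y (y, z))
      (fun z => condMeasure Prod.fst ζ y (y, z)) ≤
    1 / α * realFisherInfo M (fun z => condMeasure Prod.fst ν y (y, z))
      (fun z => condMeasure Prod.fst ζ y (y, z)) := by
  have hc : ∀ z, 0 < condMeasure Prod.fst ν y (y, z) := condMeasure_fst_pos hν hmν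
  have h1 := h _ ⟨fun z => (hc z).le, sum_condMeasure_fst hmν⟩
  rw [relEntropy_eq_realEntropy (condMeasure_fst_pos hζ hmζ),
    fisherInfo_eq_realFisherInfo hc] at h1
  exact_mod_cast h1

variable [DecidableEq Z]

theorem slowPart_isGenerator (hL : IsGenerator (scaleGenerator Q G 1)) :
    IsGenerator (slowPart G) := by
  -- The slow part is the case of zero fast rates, so its row sums come from `sum_scaleGenerator`.
  have h : scaleGenerator (fun _ => (0 : Matrix Z Z ℝ)) G 1 = slowPart G := by
    ext x x'
    simp [scaleGenerator, fastPart]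
  refine ⟨fun x x' hne => ?_, fun x => ?_⟩
  · simp only [slowPart, Matrix.of_apply]
    split_ifs with h1 h2
    · exact slowRate_nonneg hL _ _ _
    · exact absurd (Prod.ext (not_not.1 h1).symm h2.symm) hne
    · exact le_rfl
  · obtain ⟨y, z⟩ := x
    rw [← h, Fintype.sum_prod_type]
    simp only [sum_scaleGenerator (Q := fun _ => (0 : Matrix Z Z ℝ))
      (fun _ => ⟨fun _ _ _ => le_rfl, fun _ => by simp⟩)]
    rw [univ_eq_pair_of_ne (add_one_ne_self y), Finset.sum_pair (add_one_ne_self y)]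
    simp [jumpRate]

/-- Fisher information is linear in the generator and the slow part, a generator itself, contributes
a non-negative amount. This is the source of the small factor ε. -/
theorem sum_marginal_mul_realFisherInfo_le (hQ : ∀ y, IsGenerator (Q y))
    (hL : IsGenerator (scaleGenerator Q G 1)) {ε : ℝ} (hε : 0 < ε) {ν ζ : Fin 2 × Z → ℝ}
    (hν : ∀ x, 0 < ν x) (hζ : ∀ x, 0 < ζ x) :
    ∑ y, marginal Prod.fst ν y *
      realFisherInfo (Q y) (fun z => condMeasure Prod.fst ν y (y, z))
        (fun z => condMeasure Prod.fst ζ y (y, z)) ≤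
      ε * realFisherInfo (scaleGenerator Q G ε) ν ζ := by
  rw [← realFisherInfo_fastPart hQ hν hζ, scaleGenerator, realFisherInfo_smul_add, mul_add,
    ← mul_assoc, mul_one_div_cancel hε.ne', one_mul]
  exact le_add_of_nonneg_right
    (mul_nonneg hε.le (realFisherInfo_nonneg (slowPart_isGenerator hL) hν hζ))

/-- The same rates, bounded by Λ, are averaged against two conditionals, so their L¹ distance
matters. Pinsker bounds it by 2√H ≤ βH + 1/β; this form is linear in H and integrates in time at
once. -/
theorem abs_averagedGenerator_sub_le (hQ : ∀ y, IsGenerator (Q y)) (ε : ℝ) {Λ : ℝ}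
    (hΛ0 : 0 ≤ Λ) (hΛ : ∀ y y' z, |jumpRate G y y' z| ≤ Λ) {ν ζ : Fin 2 × Z → ℝ}
    (hν : ∀ x, 0 < ν x) (hζ : ∀ x, 0 < ζ x) {y : Fin 2} (hmν : 0 < marginal Prod.fst ν y)
    (hmζ : 0 < marginal Prod.fst ζ y) (y' : Fin 2) {β : ℝ} (hβ : 0 < β) :
    |averagedGenerator Prod.fst (scaleGenerator Q G ε) ν y y' -
      averagedGenerator Prod.fst (scaleGenerator Q G ε) ζ y y'| ≤
    Λ * (β * realEntropy (fun z => condMeasure Prod.fst ν y (y, z))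
      (fun z => condMeasure Prod.fst ζ y (y, z)) + 1 / β) := by
  set H := realEntropy (fun z => condMeasure Prod.fst ν y (y, z))
      (fun z => condMeasure Prod.fst ζ y (y, z))
  have hP := sq_sum_abs_sub_le_four_mul_realEntropy
    (ν := fun z => condMeasure Prod.fst ν y (y, z))
    (ζ := fun z => condMeasure Prod.fst ζ y (y, z))
    (condMeasure_fst_pos hν hmν) (condMeasure_fst_pos hζ hmζ)
    (sum_condMeasure_fst hmν) (sum_condMeasure_fst hmζ)
  have hH : 0 ≤ H := by nlinarith [hP.trans' (sq_nonneg _)]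
  have hx : ∑ z, |condMeasure Prod.fst ν y (y, z) - condMeasure Prod.fst ζ y (y, z)| ≤
      β * H + 1 / β := by
    refine abs_le_of_sq_le_sq' (hP.trans ?_) (by positivity) |>.2
    have e : β * H * (1 / β) = H := by field_simp
    nlinarith [sq_nonneg (β * H - 1 / β)]
  refine le_trans ?_ (mul_le_mul_of_nonneg_left hx hΛ0)
  rw [averagedGenerator_fst hQ, averagedGenerator_fst hQ, ← Finset.sum_sub_distrib,
    Finset.mul_sum]
  refine (Finset.abs_sum_le_sum_abs _ _).trans (Finset.sum_le_sum fun z _ => ?_)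
  rw [← mul_sub, abs_mul]
  exact mul_le_mul_of_nonneg_right (hΛ _ _ _) (abs_nonneg _)

theorem abs_log_div_le {k a b : ℝ} (hk : 0 < k) (ha : k ≤ a) (ha1 : a ≤ 1) (hb : k ≤ b)
    (hb1 : b ≤ 1) : |Real.log (a / b)| ≤ -Real.log k := by
  have ha0 := hk.trans_le ha
  have hb0 := hk.trans_le hb
  rw [Real.log_div ha0.ne' hb0.ne', abs_le]
  constructor <;> linarith [Real.log_le_log hk ha, Real.log_le_log hk hb,
    Real.log_nonpos ha0.le ha1, Real.log_nonpos hb0.le hb1]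

/-- The excess entropy production of the coarse-grained dynamics relative to the effective one. -/
theorem sum_coarse_entropy_production_le (hQ : ∀ y, IsGenerator (Q y))
    (hL : IsGenerator (scaleGenerator Q G 1)) {ε : ℝ} (hε : 0 < ε) {Λ : ℝ} (hΛ0 : 0 ≤ Λ)
    (hΛ : ∀ y y' z, |jumpRate G y y' z| ≤ Λ) {α C β : ℝ} (hα : 0 < α) (hβ : 0 < β)
    {ν ζ : Fin 2 × Z → ℝ} {η : Fin 2 → ℝ}
    (hν1 : ∑ y, marginal Prod.fst ν y = 1) (hν : ∀ x, 0 < ν x) (hζ : ∀ x, 0 < ζ x)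
    (hmν : ∀ y, 0 < marginal Prod.fst ν y) (hmζ : ∀ y, 0 < marginal Prod.fst ζ y)
    (hη : ∀ y, 0 < η y) (hC : ∀ y, |Real.log (marginal Prod.fst ν y / η y)| ≤ C)
    (hLSI : ∀ y, LogSobolev α (Q y) (fun z => condMeasure Prod.fst ζ y (y, z))) :
    ∑ y, (((averagedGenerator Prod.fst (scaleGenerator Q G ε) ν)ᵀ *ᵥ marginal Prod.fst ν) y *
        Real.log (marginal Prod.fst ν y / η y) +
      ((averagedGenerator Prod.fst (scaleGenerator Q G ε) ν)ᵀ *ᵥ marginal Prod.fst ν) y -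
      marginal Prod.fst ν y *
        ((averagedGenerator Prod.fst (scaleGenerator Q G ε) ζ)ᵀ *ᵥ η) y / η y) ≤
    2 * C * Λ * (β * (ε / α) * realFisherInfo (scaleGenerator Q G ε) ν ζ + 1 / β) := by
  set A := averagedGenerator Prod.fst (scaleGenerator Q G ε) ν with hA
  set N := averagedGenerator Prod.fst (scaleGenerator Q G ε) ζ with hN
  set a := marginal Prod.fst ν with ha
  set H : Fin 2 → ℝ := fun y => realEntropy (fun z => condMeasure Prod.fst ν y (y, z))
      (fun z => condMeasure Prod.fst ζ y (y, z)) with hH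
  set R : Fin 2 → ℝ := fun y => realFisherInfo (Q y)
      (fun z => condMeasure Prod.fst ν y (y, z)) (fun z => condMeasure Prod.fst ζ y (y, z)) with hR
  have hAg : IsGenerator A := averagedGenerator_isGenerator hQ hL ε fun x => (hν x).le
  have hNg : IsGenerator N := averagedGenerator_isGenerator hQ hL ε fun x => (hζ x).le
  have hC0 : 0 ≤ C := (abs_nonneg _).trans (hC 0)
  have h1 := sum_entropy_production_eq hNg a η
  have h2 := realFisherInfo_nonneg hNg hmν hη
  -- Replacing A by N splits the production into pure `N`-dissipation and an error linear in A - N.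
  have h3 : ∑ y, ((Aᵀ *ᵥ a) y * Real.log (a y / η y) + (Aᵀ *ᵥ a) y -
        a y * (Nᵀ *ᵥ η) y / η y) =
      ∑ y, ((Nᵀ *ᵥ a) y * Real.log (a y / η y) + (Nᵀ *ᵥ a) y - a y * (Nᵀ *ᵥ η) y / η y) +
      ∑ y, ∑ y', (A y y' - N y y') * a y * Real.log (a y' / η y') := by
    have e : ∑ y, ∑ y', (A y y' - N y y') * a y * Real.log (a y' / η y') =
        ∑ y, (Aᵀ *ᵥ a) y * Real.log (a y / η y) - ∑ y, (Nᵀ *ᵥ a) y * Real.log (a y / η y) := by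
      rw [sum_transpose_mulVec_mul, sum_transpose_mulVec_mul, ← Finset.sum_sub_distrib]
      refine Finset.sum_congr rfl fun y _ => ?_
      rw [← Finset.sum_sub_distrib]
      exact Finset.sum_congr rfl fun y' _ => by ring
    rw [e]
    simp only [Finset.sum_sub_distrib, Finset.sum_add_distrib, sum_transpose_mulVec hAg,
      sum_transpose_mulVec hNg]
    ring
  have h4 : ∀ y, ∑ y', (A y y' - N y y') * a y * Real.log (a y' / η y') ≤
      2 * C * Λ * (β / α * (a y * R y) + a y / β) := by
    intro y
    have hle : ∀ y', (A y y' - N y y') * a y * Real.log (a y' / η y') ≤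
        Λ * (β * (1 / α * R y) + 1 / β) * a y * C := by
      intro y'
      refine (le_abs_self _).trans ?_
      rw [abs_mul, abs_mul, abs_of_pos (hmν y)]
      have hx := abs_averagedGenerator_sub_le hQ ε hΛ0 hΛ hν hζ (hmν y) (hmζ y) y' hβ
      have hy := realEntropy_condMeasure_le (hLSI y) hν hζ (hmν y) (hmζ y)
      have hx' : |A y y' - N y y'| ≤ Λ * (β * (1 / α * R y) + 1 / β) :=
        hx.trans (mul_le_mul_of_nonneg_left
          (add_le_add_left (mul_le_mul_of_nonneg_left hy hβ.le) _) hΛ0)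
      have hx0 := (abs_nonneg _).trans hx'
      exact mul_le_mul (mul_le_mul_of_nonneg_right hx' (hmν y).le) (hC y') (abs_nonneg _)
        (mul_nonneg hx0 (hmν y).le)
    -- The bound is the same for both targets y', hence the factor 2.
    refine (Finset.sum_le_sum fun y' _ => hle y').trans (le_of_eq ?_)
    rw [Finset.sum_const, Finset.card_univ, Fintype.card_fin, nsmul_eq_mul]
    push_cast
    field_simp
  have h5 : ∑ y, ∑ y', (A y y' - N y y') * a y * Real.log (a y' / η y') ≤
      2 * C * Λ * (β / α * ∑ y, a y * R y + 1 / β) := by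
    refine (Finset.sum_le_sum fun y _ => h4 y).trans (le_of_eq ?_)
    rw [← Finset.mul_sum, Finset.sum_add_distrib, ← Finset.mul_sum, ← Finset.sum_div, hν1]
  have h6 := sum_marginal_mul_realFisherInfo_le hQ hL hε hν hζ
  rw [h3, h1]
  refine (add_le_of_nonpos_left (neg_nonpos.2 h2)).trans (h5.trans ?_)
  refine mul_le_mul_of_nonneg_left (add_le_add_left ?_ _) (by positivity)
  calc β / α * ∑ y, a y * R y
      ≤ β / α * (ε * realFisherInfo (scaleGenerator Q G ε) ν ζ) :=
        mul_le_mul_of_nonneg_left h6 (by positivity)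
    _ = β * (ε / α) * realFisherInfo (scaleGenerator Q G ε) ν ζ := by ring

end ScaleSeparation

/-! ### Integration in time and optimisation over β -/

variable {Z : Type*} [Fintype Z] [DecidableEq Z] {Q G : Fin 2 → Matrix Z Z ℝ}

/-- The entropy estimate, before optimising over `β`. -/
theorem realEntropy_coarse_sub_le (hQ : ∀ y, IsGenerator (Q y))
    (hL1 : IsGenerator (scaleGenerator Q G 1)) {ε : ℝ} (hε : 0 < ε)
    (hL : IsGenerator (scaleGenerator Q G ε)) {Λ : ℝ} (hΛ0 : 0 ≤ Λ)
    (hΛ : ∀ y y' z, |jumpRate G y y' z| ≤ Λ) {α β k δ T : ℝ} (hα : 0 < α) (hβ : 0 < β)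
    (hk : 0 < k) (hδ : 0 ≤ δ) {μ : ℝ → Fin 2 × Z → ℝ} {ρ : Fin 2 × Z → ℝ} {m η : ℝ → Fin 2 → ℝ}
    (hρ : IsStationaryMeasure (scaleGenerator Q G ε) ρ)
    (hμ : IsForwardSolution (fun _ => scaleGenerator Q G ε) T μ)
    (hm : IsCoarseGrained Prod.fst (scaleGenerator Q G ε) T μ m)
    (hη : IsEffective Prod.fst (scaleGenerator Q G ε) T ρ η)
    (hLSI : ∀ y, LogSobolev α (Q y) (fun z => condMeasure Prod.fst ρ y (y, z)))
    (hρ0 : ∀ x, 0 < ρ x) (hρm : ∀ y, 0 < marginal Prod.fst ρ y)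
    (hμ0 : ∀ t ∈ Icc δ T, ∀ x, 0 < μ t x)
    (hmk : ∀ t ∈ Icc δ T, ∀ y, k ≤ m t y) (hηk : ∀ t ∈ Icc δ T, ∀ y, k ≤ η t y)
    {t : ℝ} (ht : t ∈ Icc δ T) :
    realEntropy (m t) (η t) - realEntropy (m δ) (η δ) ≤
      2 * -Real.log k * Λ * (β * (ε / α) * (realEntropy (μ δ) ρ - realEntropy (μ t) ρ) +
        (t - δ) / β) := by
  have hsub : Icc δ T ⊆ Icc 0 T := Icc_subset_Icc_left hδ
  have hmμ : ∀ t ∈ Icc δ T, m t = marginal Prod.fst (μ t) := fun t ht =>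
    hm.eq_marginal hQ hμ (hsub ht)
  have hle1 : ∀ p : Fin 2 → ℝ, p ∈ stdSimplex ℝ (Fin 2) → ∀ y, p y ≤ 1 := fun p hp y => by
    rw [← hp.2]
    exact Finset.single_le_sum (fun y _ => hp.1 y) (Finset.mem_univ y)
  set c := 2 * -Real.log k * Λ with hc
  let D : ℝ → ℝ := fun u =>
    ∑ y, (((averagedGenerator Prod.fst (scaleGenerator Q G ε) (μ u))ᵀ *ᵥ m u) y *
        Real.log (m u y / η u y) +
      ((averagedGenerator Prod.fst (scaleGenerator Q G ε) (μ u))ᵀ *ᵥ m u) y -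
      m u y * ((averagedGenerator Prod.fst (scaleGenerator Q G ε) ρ)ᵀ *ᵥ η u) y / η u y)
  -- This combination is a Lyapunov function: the dissipation of H(μ|ρ) and the drift -u/β offset
  -- the error, so comparing its values at δ and t avoids integrals.
  have hD : ∀ u ∈ Icc δ T, HasDerivWithinAt
      (fun u => realEntropy (m u) (η u) + c * (β * (ε / α) * realEntropy (μ u) ρ - u / β))
      (D u + c * (β * (ε / α) * -realFisherInfo (scaleGenerator Q G ε) (μ u) ρ - 1 / β))
      (Icc δ T) u := by
    intro u hu
    have h1 := (hasDerivWithinAt_realEntropy (hm.1 u (hsub hu)).2 (hη u (hsub hu)).2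
      (fun y => hk.trans_le (hmk u hu y)) (fun y => hk.trans_le (hηk u hu y))).mono hsub
    have h2 := (hasDerivWithinAt_realEntropy_solution hL hμ (hρ.isForwardSolution T) (hsub hu)
      (hμ0 u hu) hρ0).mono hsub
    exact h1.add (((h2.const_mul _).sub ((hasDerivWithinAt_id u _).div_const β)).const_mul c)
  have hanti := antitoneOn_of_hasDerivWithinAt_nonpos (convex_Icc δ T)
    (fun u hu => (hD u hu).continuousWithinAt)
    (fun u hu => (hD u (interior_subset hu)).mono interior_subset) (fun u hu => by
      have hu' : u ∈ Icc δ T := interior_subset hu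
      have hmu := hmμ u hu'
      have hpos : ∀ y, 0 < marginal Prod.fst (μ u) y := fun y => by
        rw [← hmu]; exact hk.trans_le (hmk u hu' y)
      have h := sum_coarse_entropy_production_le hQ hL1 hε hΛ0 hΛ hα hβ
        (C := -Real.log k) (ν := μ u) (ζ := ρ) (η := η u)
        (by rw [← hmu]; exact (hm.1 u (hsub hu')).1.2) (hμ0 u hu') hρ0 hpos hρm
        (fun y => hk.trans_le (hηk u hu' y))
        (fun y => by
          rw [← hmu]
          exact abs_log_div_le hk (hmk u hu' y) (hle1 _ (hm.1 u (hsub hu')).1 y) (hηk u hu' y)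
            (hle1 _ (hη u (hsub hu')).1 y)) hLSI
      rw [← hmu] at h
      have h' : D u ≤ c * (β * (ε / α) * realFisherInfo (scaleGenerator Q G ε) (μ u) ρ + 1 / β) :=
        h
      linarith)
  have h := hanti (left_mem_Icc.2 (ht.1.trans ht.2)) ht ht.1
  simp only at h
  have e : (t - δ) / β = t / β - δ / β := sub_div _ _ _
  rw [e]
  linarith

end MarkovCG

theorem mainTheorem6 {Z : Type*} [Fintype Z] [DecidableEq Z]
    (Q G : Fin 2 → Matrix Z Z ℝ)
    (hQ : ∀ y, IsIrreducibleGenerator (Q y))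
    (hL : ∀ ε : ℝ, 0 < ε → IsIrreducibleGenerator (scaleGenerator Q G ε))
    (T ε₀ α : ℝ) (hT : 0 < T) (hε₀ : 0 < ε₀) (hα : 0 < α)
    (ρ : ℝ → Fin 2 × Z → ℝ)
    (hρ : ∀ ε ∈ Ioo 0 ε₀, IsStationaryMeasure (scaleGenerator Q G ε) (ρ ε))
    (hLSI : ∀ ε ∈ Ioo 0 ε₀, ∀ y : Fin 2,
      LogSobolev α (Q y) (fun z => condMeasure Prod.fst (ρ ε) y (y, z)))
    (μ : ℝ → ℝ → Fin 2 × Z → ℝ)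
    (hμ : ∀ ε ∈ Ioo 0 ε₀, IsForwardSolution (fun _ => scaleGenerator Q G ε) T (μ ε))
    (m η : ℝ → ℝ → Fin 2 → ℝ)
    (hm : ∀ ε ∈ Ioo 0 ε₀, IsCoarseGrained Prod.fst (scaleGenerator Q G ε) T (μ ε) (m ε))
    (hη : ∀ ε ∈ Ioo 0 ε₀, IsEffective Prod.fst (scaleGenerator Q G ε) T (ρ ε) (η ε))
    (m₀ η₀ : Fin 2 → ℝ)
    (hm₀ : Tendsto (fun ε => m ε 0) (𝓝[>] 0) (𝓝 m₀))
    (hη₀ : Tendsto (fun ε => η ε 0) (𝓝[>] 0) (𝓝 η₀))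
    (δ : ℝ) (hδ : 0 < δ) :
    ∃ c : ℝ, 0 < c ∧ ∀ ε ∈ Ioo 0 ε₀, ∀ t ∈ Icc δ T,
      relEntropy (m ε δ) (η ε δ) ≠ ⊤ ∧
      relEntropy (μ ε 0) (ρ ε) ≠ ⊤ ∧
      relEntropy (μ ε t) (ρ ε) ≤ relEntropy (μ ε 0) (ρ ε) ∧
      relEntropy (m ε t) (η ε t) ≤ relEntropy (m ε δ) (η ε δ) +
        ((c * √(2 * ε * T / α) *
          √((relEntropy (μ ε 0) (ρ ε) - relEntropy (μ ε t) (ρ ε)).toReal) : ℝ) : EReal) := by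
  rcases lt_or_ge T δ with hTδ | hδT
  · exact ⟨1, one_pos, fun ε _ t ht => absurd (ht.1.trans ht.2) (not_le.2 hTδ)⟩
  have hne : Nonempty Z := by
    by_contra hZ
    rw [not_nonempty_iff] at hZ
    have := (hρ (ε₀ / 2) ⟨by positivity, half_lt_self hε₀⟩).1.2
    simp at this
  have hQ' : ∀ y, IsGenerator (Q y) := fun y => (hQ y).1
  have hL1 := (hL 1 one_pos).1
  obtain ⟨Λ, hΛ, hΛb⟩ := exists_abs_jumpRate_le G
  obtain ⟨k₁, hk₁, h₁⟩ := exists_le_marginal hQ hL hε₀ hδ hδT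
  obtain ⟨k₂, hk₂, h₂⟩ := exists_le_effective hQ hL hε₀ hδ hδT
  -- The cap 1/2 makes -log k strictly positive, hence also the final constant.
  have hk : 0 < min (min k₁ k₂) (1 / 2) := by positivity
  set k := min (min k₁ k₂) (1 / 2) with hkdef
  have hlog : 0 < -Real.log k :=
    neg_pos.2 (Real.log_neg hk ((min_le_right _ _).trans_lt (by norm_num)))
  refine ⟨2 * (2 * -Real.log k * Λ), by positivity, fun ε hε t ht => ?_⟩
  have hpos : ∀ u : ℝ, 0 < u → u ≤ T → ∀ x, 0 < μ ε u x := fun u hu huT x => by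
    obtain ⟨k', hk', h'⟩ := exists_le_apply hQ hL hε₀ hu huT
    exact hk'.trans_le (h' ε hε _ (hμ ε hε) u ⟨le_rfl, huT⟩ x)
  have hρ0 : ∀ x, 0 < ρ ε x := fun x => by
    obtain ⟨k', hk', h'⟩ := exists_le_apply hQ hL hε₀ hT le_rfl
    exact hk'.trans_le (h' ε hε _ ((hρ ε hε).isForwardSolution T) T ⟨le_rfl, le_rfl⟩ x)
  have hρm : ∀ y, 0 < marginal Prod.fst (ρ ε) y := fun y =>
    hk₁.trans_le (h₁ ε hε _ ((hρ ε hε).isForwardSolution T) δ ⟨le_rfl, hδT⟩ y)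
  have hmk : ∀ u ∈ Icc δ T, ∀ y, k ≤ m ε u y := fun u hu y => by
    rw [(hm ε hε).eq_marginal hQ' (hμ ε hε) ⟨hδ.le.trans hu.1, hu.2⟩]
    exact ((min_le_left _ _).trans (min_le_left _ _)).trans (h₁ ε hε _ (hμ ε hε) u hu y)
  have hηk : ∀ u ∈ Icc δ T, ∀ y, k ≤ η ε u y := fun u hu y =>
    ((min_le_left _ _).trans (min_le_right _ _)).trans
      (h₂ ε hε _ (hρ ε hε) _ (hη ε hε) u hu y)
  have hanti := antitoneOn_realEntropy (hL ε hε.1).1 (hμ ε hε) (hρ ε hε) hρ0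
    (fun u hu => hpos u hu.1 hu.2.le)
  have ht0 : t ∈ Icc 0 T := ⟨hδ.le.trans ht.1, ht.2⟩
  have hS0 := hanti ⟨le_rfl, hT.le⟩ ht0 ht0.1
  have hSδ := hanti ⟨le_rfl, hT.le⟩ ⟨hδ.le, hδT⟩ hδ.le
  simp only at hS0 hSδ
  have hε0 := hε.1
  have hest : realEntropy (m ε t) (η ε t) - realEntropy (m ε δ) (η ε δ) ≤
      2 * √(2 * -Real.log k * Λ * (ε / α) *
        (realEntropy (μ ε 0) (ρ ε) - realEntropy (μ ε t) (ρ ε)) *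
        (2 * -Real.log k * Λ * T)) := by
    -- The parameter β is free for each ε and t, and the constants do not depend on it.
    refine le_two_mul_sqrt_of_forall_le (mul_nonneg (by positivity) (sub_nonneg.2 hS0))
      (by positivity) fun β hβ => ?_
    have h := realEntropy_coarse_sub_le hQ' hL1 hε.1 (hL ε hε.1).1 hΛ.le hΛb hα hβ hk hδ.le
      (hρ ε hε) (hμ ε hε) (hm ε hε) (hη ε hε) (hLSI ε hε) hρ0 hρm
      (fun u hu => hpos u (hδ.trans_le hu.1) hu.2) hmk hηk ht
    refine h.trans ?_
    have e : β * (2 * -Real.log k * Λ * (ε / α) *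
        (realEntropy (μ ε 0) (ρ ε) - realEntropy (μ ε t) (ρ ε))) +
        2 * -Real.log k * Λ * T / β = 2 * -Real.log k * Λ * (β * (ε / α) *
        (realEntropy (μ ε 0) (ρ ε) - realEntropy (μ ε t) (ρ ε)) + T / β) := by ring
    rw [e]
    refine mul_le_mul_of_nonneg_left (add_le_add ?_ ?_) (by positivity)
    -- Monotonicity of H(μ|ρ) replaces its value at δ by the larger one at 0.
    · exact mul_le_mul_of_nonneg_left (by linarith) (by positivity)
    · exact div_le_div_of_nonneg_right (by linarith [ht.2]) hβ.le
  rw [relEntropy_eq_realEntropy fun y => hk.trans_le (hηk δ ⟨le_rfl, hδT⟩ y),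
    relEntropy_eq_realEntropy fun y => hk.trans_le (hηk t ht y),
    relEntropy_eq_realEntropy hρ0, relEntropy_eq_realEntropy hρ0]
  refine ⟨EReal.coe_ne_top _, EReal.coe_ne_top _, EReal.coe_le_coe_iff.2 hS0, ?_⟩
  rw [← EReal.coe_sub, EReal.toReal_coe, ← EReal.coe_add, EReal.coe_le_coe_iff,
    mul_assoc, ← Real.sqrt_mul (by positivity)]
  refine sub_le_iff_le_add'.1 (hest.trans ?_)
  rw [mul_assoc 2 (2 * -Real.log k * Λ)]
  refine mul_le_mul_of_nonneg_left ?_ zero_le_two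
  rw [← Real.sqrt_sq (show 0 ≤ 2 * -Real.log k * Λ by positivity),
    ← Real.sqrt_mul (by positivity), Real.sqrt_sq (by positivity)]
  refine Real.sqrt_le_sqrt ?_
  have hΔ := sub_nonneg.2 hS0
  set Δ := realEntropy (μ ε 0) (ρ ε) - realEntropy (μ ε t) (ρ ε)
  -- The estimate holds without the 2 under the root; non-negativity allows doubling to the stated
  -- form.
  have h0 : 0 ≤ (2 * -Real.log k * Λ) ^ 2 * (ε * T / α * Δ) := by positivity
  calc _ = (2 * -Real.log k * Λ) ^ 2 * (ε * T / α * Δ) := by ring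
    _ ≤ 2 * ((2 * -Real.log k * Λ) ^ 2 * (ε * T / α * Δ)) := by linarith
    _ = _ := by ring
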